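/- **Setting.** A finite walk of length $L(\omega)=k$ is a sequence $\omega=(\omega(0),\dots,\omega(k))$ of integers with $\omega(0)=0$ and $|\omega(i)-\omega(i+1)|=1$. Let $T_0^M(\omega)=0$ and, for $i\ge 1$, let $T_i^M(\omega)$ be the least $j>T_{i-1}^M(\omega)$ with $\omega(j)\in 2^M\mathbb Z\setminus\{\omega(T_{i-1}^M(\omega))\}$ ($+\infty$ if there is none). Let $2^{-M}Q_M\omega$ be the walk $i\mapsto 2^{-M}\omega(T_i^M(\omega))$, of length $\max\{i:T_i^M(\omega)<\infty\}$. For $N\ge1$ let $W_{N,\pm}$ be the set of finite walks $\omega$ with $L(\omega)=T_1^N(\omega)$ and $\omega(L(\omega))=\pm2^N$. For $u\ge 0$ put $x_u=\dfrac{2}{1+\sqrt{1+8u^2}}$ and define, with $0^0=1$, $$P^u_{1,+}(\{\omega\})=u^{L(\omega)-2}x_u^{L(\omega)-1}\quad(\omega\in W_{1,+}),$$ $$P^u_{N+1,+}(\{\omega\})=P^u_{1,+}(\{\omega'\})\prod_{j=1}^{L(\omega')}P^u_{N,+}(\{\widetilde\omega_j\})\quad(\omega\in W_{N+1,+}),$$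 where $\omega'=2^{-N}Q_N\omega$ and $\widetilde\omega_j\in W_{N,+}$ is the piece of $\omega$ between the times $T_{j-1}^N(\omega)$ and $T_j^N(\omega)$, translated to start at $0$ and multiplied by the sign of $\omega(T_j^N(\omega))-\omega(T_{j-1}^N(\omega))$. For $\omega\in W_{N,-}$ let $P^u_{N,-}(\{\omega\})=P^u_{N,+}(\{-\omega\})$. Let $W_\infty$ be the set of infinite nearest-neighbour walks on $\mathbb Z$ started at $0$, with the $\sigma$-algebra generated by the cylinder sets. The law $P^u$ of the Denker–Hattori self-interacting walk is a probability measure on $W_\infty$ such that, for all $N\ge1$ and all $\widetilde\omega\in W_{N,\pm}$, $$P^u(\{\omega:\omega(j)=\widetilde\omega(j),\ 0\le j\le L(\widetilde\omega)\})=\tfrac12P^u_{N,\pm}(\{\widetilde\omega\}).$$ For $n\ge 1$ let $R_n(\omega)$ be the number of points that $\omega\in W_\infty$ visits before it hits $\{\pm2^n\}$. **Theorem 1.2.** Let $u\ge0$. A measure $P^u$ as above exists, and there is a probability measure $\widetilde P^u$ on $[0,1]$, depending only on $u$, with distribution function $f_u$, such that the following hold. 1. Under $P^u$, the random variables $R_n/2^n-1$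 converge weakly to $\widetilde P^u$ as $n\to\infty$. 2. If $u>0$, then $f=f_u$ satisfies $$f(x)=\begin{cases}\Phi(A_{u,0};f(2x)),&0\le x\le 1/2,\\ \Phi(A_{u,1};f(2x-1)),&1/2\le x\le1,\end{cases}\tag{1.1}$$ where $\Phi(A;z)=\dfrac{az+b}{cz+d}$ for $A=\begin{pmatrix}a&b\\c&d\end{pmatrix}$, the denominators occurring in (1.1) do not vanish, and $$A_{u,0}=\begin{pmatrix}x_u&0\\-u^2x_u^2&1\end{pmatrix},\qquad A_{u,1}=\begin{pmatrix}0&x_u\\-u^2x_u^2&1-u^2x_u^2\end{pmatrix}.$$ 3. If $u=1$, then $\widetilde P^u$ is absolutely continuous with respect to Lebesgue measure on $[0,1]$. If $u\ne1$, then $\widetilde P^u$ is singular with respect to Lebesgue measure on $[0,1]$. -/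

import Mathlib

open MeasureTheory ProbabilityTheory Set Filter Topology

/-- A finite integer sequence `(pos 0, pos 1, …, pos len)`. Only the values of `pos` at the
times `0, …, len` carry information; every notion below looks at these values only. -/
structure FinPath where
  len : ℕ
  pos : ℕ → ℤ

namespace FinPath

/-- Membership in `W*`: the sequence starts at `0` and makes nearest-neighbour steps. -/
def IsWalk (ω : FinPath) : Prop :=
  ω.pos 0 = 0 ∧ ∀ i < ω.len, |ω.pos i - ω.pos (i + 1)| = 1

/-- The times `T_i^M`: `T_0^M = 0`, and `T_{i+1}^M` is the least `j` with `T_i^M < j ≤ len`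
such that `ω(j)` lies in `2^M ℤ` and differs from `ω(T_i^M)`; it is `⊤` if there is none. -/
noncomputable def decTime (M : ℕ) (ω : FinPath) : ℕ → ℕ∞
  | 0 => 0
  | i + 1 => sInf {t : ℕ∞ | ∃ j : ℕ, t = (j : ℕ∞) ∧ decTime M ω i < (j : ℕ∞) ∧ j ≤ ω.len ∧
      (2 : ℤ) ^ M ∣ ω.pos j ∧ ω.pos j ≠ ω.pos (decTime M ω i).toNat}

/-- The decimated and rescaled path `2^{-M} Q_M ω`, that is `i ↦ 2^{-M} ω(T_i^M)`, of length
`max {i | T_i^M < ∞}`. -/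
noncomputable def decimate (M : ℕ) (ω : FinPath) : FinPath where
  len := sSup {i : ℕ | ω.decTime M i < ⊤}
  pos := fun i => ω.pos (ω.decTime M i).toNat / (2 : ℤ) ^ M

/-- The signed `j`-th segment (`j ≥ 1`) of `ω` at level `N`: the piece of `ω` between the times
`T_{j-1}^N` and `T_j^N`, translated to start at `0` and multiplied by the sign of its total
displacement. -/
noncomputable def segment (N j : ℕ) (ω : FinPath) : FinPath where
  len := (ω.decTime N j).toNat - (ω.decTime N (j - 1)).toNat
  pos := fun t =>
    Int.sign (ω.pos (ω.decTime N j).toNat - ω.pos (ω.decTime N (j - 1)).toNat) *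
      (ω.pos ((ω.decTime N (j - 1)).toNat + t) - ω.pos (ω.decTime N (j - 1)).toNat)

/-- The reflected path `-ω`. -/
def neg (ω : FinPath) : FinPath where
  len := ω.len
  pos := fun t => -ω.pos t

/-- Membership in `W_{N,+}`: a walk stopped at `T_1^N`, where it sits at `2^N`. -/
def MemPlus (N : ℕ) (ω : FinPath) : Prop :=
  ω.IsWalk ∧ (ω.len : ℕ∞) = ω.decTime N 1 ∧ ω.pos ω.len = 2 ^ N

/-- Membership in `W_{N,-}`: a walk stopped at `T_1^N`, where it sits at `-2^N`. -/
def MemMinus (N : ℕ) (ω : FinPath) : Prop :=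
  ω.IsWalk ∧ (ω.len : ℕ∞) = ω.decTime N 1 ∧ ω.pos ω.len = -2 ^ N

end FinPath

/-- `x_u = 2 / (1 + √(1 + 8 u²))`. -/
noncomputable def xParam (u : ℝ) : ℝ := 2 / (1 + Real.sqrt (1 + 8 * u ^ 2))

/-- The mass `P_{N,+}^u({ω})` of `ω ∈ W_{N,+}`, `N ≥ 1`. At level `1` it is
`u^{L(ω)-2} x_u^{L(ω)-1}` with `0^0 = 1`; at level `N + 1` it is
`P_{1,+}^u({ω'})` times the product over `1 ≤ j ≤ L(ω')` of the masses under `P_{N,+}^u` of the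
signed segments, where `ω' = 2^{-N} Q_N ω`. Level `0` is not used. -/
noncomputable def massPlus (u : ℝ) : ℕ → FinPath → ℝ
  | 0, _ => 1
  | 1, ω => u ^ (ω.len - 2) * xParam u ^ (ω.len - 1)
  | N + 2, ω =>
      massPlus u 1 (ω.decimate (N + 1)) *
        ∏ j ∈ Finset.Icc 1 (ω.decimate (N + 1)).len, massPlus u (N + 1) (ω.segment (N + 1) j)

/-- The mass `P_{N,-}^u({ω}) = P_{N,+}^u({-ω})` of `ω ∈ W_{N,-}`. -/
noncomputable def massMinus (u : ℝ) (N : ℕ) (ω : FinPath) : ℝ := massPlus u N ω.neg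

/-- The space `W_∞` of infinite nearest-neighbour paths on `ℤ` started at `0`. Its σ-algebra, the
trace of the product σ-algebra, is the one generated by the cylinder sets. -/
abbrev InfWalk : Type :=
  {ω : ℕ → ℤ // ω 0 = 0 ∧ ∀ i, |ω i - ω (i + 1)| = 1}

/-- The set of infinite walks whose initial piece is `ω`. -/
def cylinderOf (ω : FinPath) : Set InfWalk :=
  {η | ∀ j ≤ ω.len, η.1 j = ω.pos j}

/-- `P` is the law `P^u` of the Denker–Hattori self-interacting walk with parameter `u`: a
probability measure on `W_∞` that gives the cylinder over each `ω ∈ W_{N,±}`, `N ≥ 1`, the mass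
`P_{N,±}^u({ω}) / 2`. -/
def IsDenkerHattoriLaw (u : ℝ) (P : ProbabilityMeasure InfWalk) : Prop :=
  ∀ N : ℕ, 1 ≤ N → ∀ ω : FinPath,
    (ω.MemPlus N →
      (P : Measure InfWalk) (cylinderOf ω) = ENNReal.ofReal (massPlus u N ω / 2)) ∧
    (ω.MemMinus N →
      (P : Measure InfWalk) (cylinderOf ω) = ENNReal.ofReal (massMinus u N ω / 2))

/-- `R_n(ω)`: the number of points that `ω` visits before it hits `{2^n, -2^n}`. -/
noncomputable def walkRange (n : ℕ) (ω : InfWalk) : ℕ :=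
  Set.ncard {x : ℤ | ∃ j : ℕ, ω.1 j = x ∧ ∀ i ≤ j, ω.1 i ≠ 2 ^ n ∧ ω.1 i ≠ -2 ^ n}

/-- The denominator `c z + d` of `Φ(A; z)`. -/
def moebiusDenom (A : Matrix (Fin 2) (Fin 2) ℝ) (z : ℝ) : ℝ := A 1 0 * z + A 1 1

/-- `Φ(A; z) = (a z + b) / (c z + d)` for `A = !![a, b; c, d]`. -/
noncomputable def moebius (A : Matrix (Fin 2) (Fin 2) ℝ) (z : ℝ) : ℝ :=
  (A 0 0 * z + A 0 1) / moebiusDenom A z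

/-- The matrix `A_{u,0}`. -/
noncomputable def deRhamMatrix0 (u : ℝ) : Matrix (Fin 2) (Fin 2) ℝ :=
  !![xParam u, 0; -(u ^ 2 * xParam u ^ 2), 1]

/-- The matrix `A_{u,1}`. -/
noncomputable def deRhamMatrix1 (u : ℝ) : Matrix (Fin 2) (Fin 2) ℝ :=
  !![0, xParam u; -(u ^ 2 * xParam u ^ 2), 1 - u ^ 2 * xParam u ^ 2]

/-- `f` satisfies on `[0,1]` the functional equation `f(x) = Φ(A_{u,0}; f(2x))` for
`0 ≤ x ≤ 1/2` and `f(x) = Φ(A_{u,1}; f(2x-1))` for `1/2 ≤ x ≤ 1`; the quotients have to be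
genuine, that is, their denominators do not vanish. -/
def SatisfiesDeRham (u : ℝ) (f : ℝ → ℝ) : Prop :=
  (∀ x ∈ Icc (0 : ℝ) (1 / 2),
    moebiusDenom (deRhamMatrix0 u) (f (2 * x)) ≠ 0 ∧
      f x = moebius (deRhamMatrix0 u) (f (2 * x))) ∧
  (∀ x ∈ Icc (1 / 2 : ℝ) 1,
    moebiusDenom (deRhamMatrix1 u) (f (2 * x - 1)) ≠ 0 ∧
      f x = moebius (deRhamMatrix1 u) (f (2 * x - 1)))

/-
A path that first leaves `(-2 ^ (N + 1), 2 ^ (N + 1))` is, at scale `2 ^ N`, a sequence of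
excursions from `0` to `±2 ^ N` and back, followed by two crossings in the same direction, and the
weights are multiplicative along this decomposition. Summing the geometric series over the
excursions that keep the range small shows that the distribution functions of the rescaled excess
range satisfy the de Rham recursion (1.1) from one scale to the next. They decrease in `N`, and
their limit solves (1.1).

For `u = 1` the solution is `2 y / (1 + y)`, and for `u = 0` the law is the point mass at `0`. For
all other `u`, Möbius maps preserve cross-ratios, so the values of `f` at the points of relative
position `0`, `1/4`, `1/2`, `1` in any dyadic interval have cross-ratio `x_u`; a nonzero derivative
would force in the limit the cross-ratio `1/2` of these points themselves. Hence `f' = 0` almost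
everywhere.
-/

open scoped ENNReal

section DeRhamEquation

/-- The maps of de Rham's functional equation `F y = g₀ (F (2 y))` for `y ≤ 1/2`,
`F y = g₁ (F (2 y - 1))` for `y ≥ 1/2`: they carry `[0, 1]` monotonically onto adjacent intervals
that cover `[0, 1]`. -/
structure IsDeRhamPair (g₀ g₁ : ℝ → ℝ) : Prop where
  monotoneOn_left : MonotoneOn g₀ (Icc 0 1)
  monotoneOn_right : MonotoneOn g₁ (Icc 0 1)
  continuousOn_left : ContinuousOn g₀ (Icc 0 1)
  continuousOn_right : ContinuousOn g₁ (Icc 0 1)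
  left_zero : g₀ 0 = 0
  left_one : g₀ 1 = g₁ 0
  right_one : g₁ 1 = 1

/-- Distribution functions of probability measures on `[0, 1]`. -/
structure IsUnitCdf (F : ℝ → ℝ) : Prop where
  monotone : Monotone F
  rightContinuous : ∀ y, ContinuousWithinAt F (Ici y) y
  of_neg : ∀ {y}, y < 0 → F y = 0
  of_one_le : ∀ {y}, 1 ≤ y → F y = 1

/-- The operator whose fixed points are the solutions of de Rham's functional equation. At
`y = 1/2` the right branch is used, which makes the operator preserve right-continuity. -/
noncomputable def deRhamStep (g₀ g₁ F : ℝ → ℝ) (y : ℝ) : ℝ :=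
  if y < 1 / 2 then g₀ (F (2 * y)) else g₁ (F (2 * y - 1))

/-- The iterates of `deRhamStep` at the distribution function of the point mass at `0`. -/
noncomputable def approxCdf (g₀ g₁ : ℝ → ℝ) (n : ℕ) : ℝ → ℝ :=
  (deRhamStep g₀ g₁)^[n] ((Ici 0).indicator 1)

/-- The pointwise limit of the decreasing sequence `approxCdf g₀ g₁`. -/
noncomputable def limitCdf (g₀ g₁ : ℝ → ℝ) (y : ℝ) : ℝ := ⨅ n, approxCdf g₀ g₁ n y

variable {g₀ g₁ F G : ℝ → ℝ}

namespace IsUnitCdf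

lemma mem_Icc (hF : IsUnitCdf F) (y : ℝ) : F y ∈ Icc (0 : ℝ) 1 := by
  constructor
  · rw [← hF.of_neg (show min y (-1) < 0 by simp)]
    exact hF.monotone (min_le_left _ _)
  · rw [← hF.of_one_le (le_max_right y 1)]
    exact hF.monotone (le_max_left _ _)

/-- The Stieltjes function of a distribution function on `[0, 1]`, from which the law is built. -/
noncomputable def stieltjes (hF : IsUnitCdf F) : StieltjesFunction ℝ where
  toFun := F
  mono' := hF.monotone
  right_continuous' := hF.rightContinuous

lemma tendsto_atBot (hF : IsUnitCdf F) : Tendsto hF.stieltjes atBot (𝓝 0) :=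
  tendsto_const_nhds.congr' <| mem_of_superset (Iio_mem_atBot 0) fun _ hy => (hF.of_neg hy).symm

lemma tendsto_atTop (hF : IsUnitCdf F) : Tendsto hF.stieltjes atTop (𝓝 1) :=
  tendsto_const_nhds.congr' <|
    mem_of_superset (Ici_mem_atTop 1) fun _ hy => (hF.of_one_le hy).symm

/-- The probability measure with distribution function `F`. -/
noncomputable def law (hF : IsUnitCdf F) : ProbabilityMeasure ℝ :=
  ⟨hF.stieltjes.measure, hF.stieltjes.isProbabilityMeasure hF.tendsto_atBot hF.tendsto_atTop⟩

lemma cdf_law (hF : IsUnitCdf F) (y : ℝ) : cdf (hF.law : Measure ℝ) y = F y :=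
  congrArg (fun f : StieltjesFunction ℝ => f y)
    (cdf_measure_stieltjesFunction hF.stieltjes hF.tendsto_atBot hF.tendsto_atTop)

lemma law_Icc (hF : IsUnitCdf F) : (hF.law : Measure ℝ) (Icc 0 1) = 1 := by
  have left_limit : Function.leftLim hF.stieltjes 0 = 0 :=
    leftLim_eq_of_tendsto <| tendsto_const_nhds.congr' <|
      mem_of_superset self_mem_nhdsWithin fun _ hy => (hF.of_neg hy).symm
  change hF.stieltjes.measure (Icc 0 1) = 1
  rw [StieltjesFunction.measure_Icc, left_limit, show hF.stieltjes 1 = 1 from hF.of_one_le le_rfl,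
    sub_zero, ENNReal.ofReal_one]

end IsUnitCdf

lemma isUnitCdf_indicator : IsUnitCdf ((Ici 0).indicator 1) where
  monotone y z hyz := by
    by_cases hy : 0 ≤ y
    · simp [hy, hy.trans hyz]
    · simpa [hy] using indicator_nonneg (f := (1 : ℝ → ℝ)) (fun _ _ => zero_le_one) z
  rightContinuous y := by
    rcases le_or_gt 0 y with hy | hy
    · refine (continuousWithinAt_const (b := (1 : ℝ))).congr (fun z hz => ?_) (by simp [hy])
      simp [hy.trans (mem_Ici.1 hz)]
    · refine ((continuousAt_const (y := (0 : ℝ))).congr ?_).continuousWithinAt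
      filter_upwards [Iio_mem_nhds hy] with z hz
      simp [mem_Iio.1 hz]
  of_neg hy := by simp [hy]
  of_one_le hy := by simp [zero_le_one.trans hy]

namespace IsDeRhamPair

lemma left_le_right (h : IsDeRhamPair g₀ g₁) {z w : ℝ} (hz : z ∈ Icc (0 : ℝ) 1)
    (hw : w ∈ Icc (0 : ℝ) 1) : g₀ z ≤ g₁ w :=
  calc
    g₀ z ≤ g₀ 1 := h.monotoneOn_left hz (by simp) hz.2
    _ = g₁ 0 := h.left_one
    _ ≤ g₁ w := h.monotoneOn_right (by simp) hw hw.1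

lemma deRhamStep_le (h : IsDeRhamPair g₀ g₁) (hF : IsUnitCdf F) (hG : IsUnitCdf G) (hFG : F ≤ G) :
    deRhamStep g₀ g₁ F ≤ deRhamStep g₀ g₁ G := fun y => by
  unfold deRhamStep
  split_ifs
  · exact h.monotoneOn_left (hF.mem_Icc _) (hG.mem_Icc _) (hFG _)
  · exact h.monotoneOn_right (hF.mem_Icc _) (hG.mem_Icc _) (hFG _)

lemma monotone_deRhamStep (h : IsDeRhamPair g₀ g₁) (hF : IsUnitCdf F) :
    Monotone (deRhamStep g₀ g₁ F) := fun y z hyz => by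
  unfold deRhamStep
  split_ifs with hy hz
  · exact h.monotoneOn_left (hF.mem_Icc _) (hF.mem_Icc _) (hF.monotone (by linarith))
  · exact h.left_le_right (hF.mem_Icc _) (hF.mem_Icc _)
  · linarith
  · exact h.monotoneOn_right (hF.mem_Icc _) (hF.mem_Icc _) (hF.monotone (by linarith))

lemma continuousWithinAt_deRhamStep (h : IsDeRhamPair g₀ g₁) (hF : IsUnitCdf F) (y : ℝ) :
    ContinuousWithinAt (deRhamStep g₀ g₁ F) (Ici y) y := by
  have comp_affine (c : ℝ) : ContinuousWithinAt (fun z => F (2 * z - c)) (Ici y) y :=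
    (hF.rightContinuous _).comp (by fun_prop) fun z hz => by simpa using hz
  have left : ContinuousWithinAt (fun z => g₀ (F (2 * z))) (Ici y) y :=
    (h.continuousOn_left _ (hF.mem_Icc _)).comp (f := fun z => F (2 * z))
      (by simpa using comp_affine 0) fun z _ => hF.mem_Icc _
  have right : ContinuousWithinAt (fun z => g₁ (F (2 * z - 1))) (Ici y) y :=
    (h.continuousOn_right _ (hF.mem_Icc _)).comp (f := fun z => F (2 * z - 1)) (comp_affine 1)
      fun z _ => hF.mem_Icc _
  by_cases hy : y < 1 / 2
  · refine left.congr_of_eventuallyEq ?_ (if_pos hy)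
    filter_upwards [mem_nhdsWithin_of_mem_nhds (Iio_mem_nhds hy)] with z hz using if_pos hz
  · exact right.congr (fun z hz => if_neg fun hz' => hy ((mem_Ici.1 hz).trans_lt hz')) (if_neg hy)

lemma isUnitCdf_deRhamStep (h : IsDeRhamPair g₀ g₁) (hF : IsUnitCdf F) :
    IsUnitCdf (deRhamStep g₀ g₁ F) where
  monotone := h.monotone_deRhamStep hF
  rightContinuous := h.continuousWithinAt_deRhamStep hF
  of_neg hy := by rw [deRhamStep, if_pos (by linarith), hF.of_neg (by linarith), h.left_zero]
  of_one_le hy := by rw [deRhamStep, if_neg (by linarith), hF.of_one_le (by linarith), h.right_one]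

lemma isUnitCdf_approxCdf (h : IsDeRhamPair g₀ g₁) (n : ℕ) : IsUnitCdf (approxCdf g₀ g₁ n) := by
  induction n with
  | zero => exact isUnitCdf_indicator
  | succ n ih =>
    rw [approxCdf, Function.iterate_succ_apply']
    exact h.isUnitCdf_deRhamStep ih

lemma antitone_approxCdf (h : IsDeRhamPair g₀ g₁) : Antitone (approxCdf g₀ g₁) := by
  refine antitone_nat_of_succ_le fun n => ?_
  induction n with
  | zero =>
    intro y
    rcases lt_or_ge y 0 with hy | hy
    · rw [(h.isUnitCdf_approxCdf 1).of_neg hy, (h.isUnitCdf_approxCdf 0).of_neg hy]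
    · rw [show approxCdf g₀ g₁ 0 y = 1 by simp [approxCdf, hy]]
      exact ((h.isUnitCdf_approxCdf 1).mem_Icc y).2
  | succ n ih =>
    simp only [approxCdf, Function.iterate_succ_apply'] at ih ⊢
    exact h.deRhamStep_le (h.isUnitCdf_deRhamStep (h.isUnitCdf_approxCdf n))
      (h.isUnitCdf_approxCdf n) ih

lemma tendsto_approxCdf (h : IsDeRhamPair g₀ g₁) (y : ℝ) :
    Tendsto (fun n => approxCdf g₀ g₁ n y) atTop (𝓝 (limitCdf g₀ g₁ y)) :=
  tendsto_atTop_ciInf (fun _ _ hmn => h.antitone_approxCdf hmn y)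
    ⟨0, forall_mem_range.2 fun n => ((h.isUnitCdf_approxCdf n).mem_Icc y).1⟩

lemma continuousWithinAt_limitCdf (h : IsDeRhamPair g₀ g₁) (hmono : Monotone (limitCdf g₀ g₁))
    (y : ℝ) : ContinuousWithinAt (limitCdf g₀ g₁) (Ici y) y := by
  refine tendsto_order.2 ⟨fun a ha => ?_, fun a ha => ?_⟩
  · filter_upwards [self_mem_nhdsWithin] with z hz using ha.trans_le (hmono hz)
  · obtain ⟨n, hn⟩ := ((tendsto_order.1 (h.tendsto_approxCdf y)).2 a ha).exists
    have approx_lt := (tendsto_order.1 ((h.isUnitCdf_approxCdf n).rightContinuous y)).2 a hn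
    filter_upwards [approx_lt] with z hz
    exact (Antitone.le_of_tendsto (fun _ _ hmn => h.antitone_approxCdf hmn z)
      (h.tendsto_approxCdf z) n).trans_lt hz

lemma isUnitCdf_limitCdf (h : IsDeRhamPair g₀ g₁) : IsUnitCdf (limitCdf g₀ g₁) := by
  have monotone : Monotone (limitCdf g₀ g₁) := fun y z hyz =>
    le_of_tendsto_of_tendsto' (h.tendsto_approxCdf y) (h.tendsto_approxCdf z)
      fun n => (h.isUnitCdf_approxCdf n).monotone hyz
  exact
    { monotone := monotone
      rightContinuous := h.continuousWithinAt_limitCdf monotone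
      of_neg := fun hy => by simp only [limitCdf, (h.isUnitCdf_approxCdf _).of_neg hy, ciInf_const]
      of_one_le := fun hy => by
        simp only [limitCdf, (h.isUnitCdf_approxCdf _).of_one_le hy, ciInf_const] }

lemma deRhamStep_limitCdf (h : IsDeRhamPair g₀ g₁) :
    deRhamStep g₀ g₁ (limitCdf g₀ g₁) = limitCdf g₀ g₁ := by
  have lim_mem := h.isUnitCdf_limitCdf.mem_Icc
  have tendsto_within (y : ℝ) : Tendsto (fun n => approxCdf g₀ g₁ n y) atTop
      (𝓝[Icc 0 1] limitCdf g₀ g₁ y) :=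
    tendsto_nhdsWithin_iff.2 ⟨h.tendsto_approxCdf y,
      Eventually.of_forall fun n => (h.isUnitCdf_approxCdf n).mem_Icc y⟩
  funext y
  refine tendsto_nhds_unique ?_ ((h.tendsto_approxCdf y).comp (tendsto_add_atTop_nat 1))
  simp only [Function.comp_def, approxCdf, Function.iterate_succ_apply', deRhamStep]
  split_ifs
  · exact (h.continuousOn_left _ (lim_mem _)).tendsto.comp (tendsto_within _)
  · exact (h.continuousOn_right _ (lim_mem _)).tendsto.comp (tendsto_within _)

lemma limitCdf_of_half_le (h : IsDeRhamPair g₀ g₁) {y : ℝ} (hy : 1 / 2 ≤ y) :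
    limitCdf g₀ g₁ y = g₁ (limitCdf g₀ g₁ (2 * y - 1)) := by
  conv_lhs => rw [← h.deRhamStep_limitCdf, deRhamStep, if_neg hy.not_gt]

lemma left_limitCdf_zero (h : IsDeRhamPair g₀ g₁) :
    g₀ (limitCdf g₀ g₁ 0) = limitCdf g₀ g₁ 0 := by
  conv_rhs => rw [← h.deRhamStep_limitCdf, deRhamStep, if_pos (by norm_num), mul_zero]

lemma limitCdf_of_le_half (h : IsDeRhamPair g₀ g₁) (h0 : limitCdf g₀ g₁ 0 = 0) {y : ℝ}
    (hy : y ≤ 1 / 2) : limitCdf g₀ g₁ y = g₀ (limitCdf g₀ g₁ (2 * y)) := by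
  rcases hy.lt_or_eq with hy | rfl
  · conv_lhs => rw [← h.deRhamStep_limitCdf, deRhamStep, if_pos hy]
  · rw [h.limitCdf_of_half_le le_rfl, mul_one_div_cancel two_ne_zero, sub_self, h0,
      h.isUnitCdf_limitCdf.of_one_le le_rfl, h.left_one]

end IsDeRhamPair

end DeRhamEquation

section Moebius

variable {A : Matrix (Fin 2) (Fin 2) ℝ} {a b c d z w : ℝ}

lemma moebius_sub_moebius (hz : moebiusDenom A z ≠ 0) (hw : moebiusDenom A w ≠ 0) :
    moebius A z - moebius A w = A.det * (z - w) / (moebiusDenom A z * moebiusDenom A w) := by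
  rw [moebius, moebius, div_sub_div _ _ hz hw, Matrix.det_fin_two]
  simp only [moebiusDenom]
  ring

lemma monotoneOn_moebius {s : Set ℝ} (hdet : 0 ≤ A.det) (hs : ∀ z ∈ s, 0 < moebiusDenom A z) :
    MonotoneOn (moebius A) s := fun z hz w hw hzw => by
  rw [← sub_nonneg, moebius_sub_moebius (hs w hw).ne' (hs z hz).ne']
  exact div_nonneg (mul_nonneg hdet (sub_nonneg.2 hzw)) (mul_pos (hs w hw) (hs z hz)).le

lemma continuousOn_moebius {s : Set ℝ} (hs : ∀ z ∈ s, moebiusDenom A z ≠ 0) :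
    ContinuousOn (moebius A) s := by
  have denom_continuous : Continuous (moebiusDenom A) := by
    unfold moebiusDenom
    fun_prop
  exact ContinuousOn.div (by fun_prop) denom_continuous.continuousOn hs

lemma lipschitzOnWith_moebius {s : Set ℝ} {K : NNReal} {δ : ℝ} (hδ : 0 < δ)
    (hs : ∀ z ∈ s, δ ≤ moebiusDenom A z) (hK : |A.det| ≤ K * δ ^ 2) :
    LipschitzOnWith K (moebius A) s := by
  refine LipschitzOnWith.of_dist_le_mul fun z hz w hw => ?_
  have hz' := hδ.trans_le (hs z hz)
  have hw' := hδ.trans_le (hs w hw)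
  rw [Real.dist_eq, Real.dist_eq, moebius_sub_moebius hz'.ne' hw'.ne', abs_div, abs_mul,
    abs_of_pos (mul_pos hz' hw'), div_le_iff₀ (mul_pos hz' hw')]
  calc
    |A.det| * |z - w| ≤ K * δ ^ 2 * |z - w| := by gcongr
    _ ≤ K * (moebiusDenom A z * moebiusDenom A w) * |z - w| := by
      rw [sq]
      gcongr
      exacts [hs z hz, hs w hw]
    _ = K * |z - w| * (moebiusDenom A z * moebiusDenom A w) := by ring

/-- The cross ratio of four reals, in the form that depends only on the lengths of the intervals
`[a, b]`, `[b, c]`, `[c, d]` and `[a, d]` between consecutive points. -/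
noncomputable def crossRatio (a b c d : ℝ) : ℝ := (b - a) * (d - c) / ((c - b) * (d - a))

lemma crossRatio_moebius (hdet : A.det ≠ 0) (ha : moebiusDenom A a ≠ 0)
    (hb : moebiusDenom A b ≠ 0) (hc : moebiusDenom A c ≠ 0) (hd : moebiusDenom A d ≠ 0) :
    crossRatio (moebius A a) (moebius A b) (moebius A c) (moebius A d) = crossRatio a b c d := by
  have factor : A.det * A.det / (moebiusDenom A a * moebiusDenom A b * moebiusDenom A c *
      moebiusDenom A d) ≠ 0 := by positivity
  rw [crossRatio, crossRatio, moebius_sub_moebius hb ha, moebius_sub_moebius hd hc,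
    moebius_sub_moebius hc hb, moebius_sub_moebius hd ha,
    ← mul_div_mul_left ((b - a) * (d - c)) _ factor]
  congr 1 <;> field_simp

lemma crossRatio_sub_div {h : ℝ} (hh : h ≠ 0) :
    crossRatio 0 ((b - a) / h) ((c - a) / h) ((d - a) / h) = crossRatio a b c d := by
  have factor : 1 / h ^ 2 ≠ 0 := by positivity
  rw [crossRatio, crossRatio, ← mul_div_mul_left ((b - a) * (d - c)) _ factor]
  congr 1 <;> field_simp <;> ring

end Moebius

section Parameter

lemma xParam_pos (u : ℝ) : 0 < xParam u := by unfold xParam; positivity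

lemma xParam_quadratic (u : ℝ) : u ^ 2 * xParam u ^ 2 = (1 - xParam u) / 2 := by
  have hsq := Real.sq_sqrt (show 0 ≤ 1 + 8 * u ^ 2 by positivity)
  have hden : 1 + Real.sqrt (1 + 8 * u ^ 2) ≠ 0 := by positivity
  unfold xParam
  generalize Real.sqrt (1 + 8 * u ^ 2) = s at *
  field_simp
  linear_combination (-1 : ℝ) * hsq

lemma xParam_le_one (u : ℝ) : xParam u ≤ 1 := by
  have : 0 ≤ u ^ 2 * xParam u ^ 2 := by positivity
  linarith [xParam_quadratic u]

lemma xParam_zero : xParam 0 = 1 := by linarith [xParam_quadratic 0]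

lemma xParam_eq_half_iff {u : ℝ} (hu : 0 ≤ u) : xParam u = 1 / 2 ↔ u = 1 := by
  have quadratic := xParam_quadratic u
  refine ⟨fun h => ?_, fun h => ?_⟩
  · rw [h] at quadratic
    nlinarith
  · rw [h] at quadratic ⊢
    nlinarith [xParam_pos 1]

variable {u : ℝ}

lemma det_deRhamMatrix0 (u : ℝ) : (deRhamMatrix0 u).det = xParam u := by
  simp [deRhamMatrix0, Matrix.det_fin_two]

lemma det_deRhamMatrix1 (u : ℝ) : (deRhamMatrix1 u).det = u ^ 2 * xParam u ^ 3 := by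
  simp only [deRhamMatrix1, Matrix.det_fin_two_of]
  ring

lemma moebiusDenom_deRhamMatrix0 (u z : ℝ) :
    moebiusDenom (deRhamMatrix0 u) z = 1 - (1 - xParam u) / 2 * z := by
  simp only [moebiusDenom, deRhamMatrix0, Matrix.of_apply, Matrix.cons_val, xParam_quadratic]
  ring

lemma moebiusDenom_deRhamMatrix1 (u z : ℝ) :
    moebiusDenom (deRhamMatrix1 u) z = 1 - (1 - xParam u) / 2 * (1 + z) := by
  simp only [moebiusDenom, deRhamMatrix1, Matrix.of_apply, Matrix.cons_val, xParam_quadratic]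
  ring

lemma moebius_deRhamMatrix0 (u z : ℝ) :
    moebius (deRhamMatrix0 u) z = xParam u * z / (1 - (1 - xParam u) / 2 * z) := by
  rw [moebius, moebiusDenom_deRhamMatrix0]
  simp [deRhamMatrix0]

lemma moebius_deRhamMatrix1 (u z : ℝ) :
    moebius (deRhamMatrix1 u) z = xParam u / (1 - (1 - xParam u) / 2 * (1 + z)) := by
  rw [moebius, moebiusDenom_deRhamMatrix1]
  simp [deRhamMatrix1]

lemma le_moebiusDenom_deRhamMatrix0 {z : ℝ} (hz : z ∈ Icc (0 : ℝ) 1) :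
    (1 + xParam u) / 2 ≤ moebiusDenom (deRhamMatrix0 u) z := by
  rw [moebiusDenom_deRhamMatrix0]
  nlinarith [mul_nonneg (sub_nonneg.2 (xParam_le_one u)) (sub_nonneg.2 hz.2)]

lemma le_moebiusDenom_deRhamMatrix1 {z : ℝ} (hz : z ∈ Icc (0 : ℝ) 1) :
    xParam u ≤ moebiusDenom (deRhamMatrix1 u) z := by
  rw [moebiusDenom_deRhamMatrix1]
  nlinarith [mul_nonneg (sub_nonneg.2 (xParam_le_one u)) (sub_nonneg.2 hz.2)]

lemma moebiusDenom_deRhamMatrix0_pos {z : ℝ} (hz : z ∈ Icc (0 : ℝ) 1) :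
    0 < moebiusDenom (deRhamMatrix0 u) z :=
  (by linarith [xParam_pos u] : 0 < (1 + xParam u) / 2).trans_le (le_moebiusDenom_deRhamMatrix0 hz)

lemma moebiusDenom_deRhamMatrix1_pos {z : ℝ} (hz : z ∈ Icc (0 : ℝ) 1) :
    0 < moebiusDenom (deRhamMatrix1 u) z :=
  (xParam_pos u).trans_le (le_moebiusDenom_deRhamMatrix1 hz)

lemma isDeRhamPair_moebius (u : ℝ) :
    IsDeRhamPair (moebius (deRhamMatrix0 u)) (moebius (deRhamMatrix1 u)) where
  monotoneOn_left := monotoneOn_moebius (det_deRhamMatrix0 u ▸ (xParam_pos u).le)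
    fun _ => moebiusDenom_deRhamMatrix0_pos
  monotoneOn_right := monotoneOn_moebius
    (det_deRhamMatrix1 u ▸ mul_nonneg (sq_nonneg u) (pow_nonneg (xParam_pos u).le 3))
    fun _ => moebiusDenom_deRhamMatrix1_pos
  continuousOn_left := continuousOn_moebius fun _ hz => (moebiusDenom_deRhamMatrix0_pos hz).ne'
  continuousOn_right := continuousOn_moebius fun _ hz => (moebiusDenom_deRhamMatrix1_pos hz).ne'
  left_zero := by simp [moebius_deRhamMatrix0]
  left_one := by simp [moebius_deRhamMatrix0, moebius_deRhamMatrix1]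
  right_one := by
    rw [moebius_deRhamMatrix1, show 1 - (1 - xParam u) / 2 * (1 + 1) = xParam u by ring,
      div_self (xParam_pos u).ne']

/-- The distribution function `f_u`. -/
noncomputable def deRhamCdf (u : ℝ) : ℝ → ℝ :=
  limitCdf (moebius (deRhamMatrix0 u)) (moebius (deRhamMatrix1 u))

lemma isUnitCdf_deRhamCdf (u : ℝ) : IsUnitCdf (deRhamCdf u) :=
  (isDeRhamPair_moebius u).isUnitCdf_limitCdf

lemma deRhamCdf_zero (hu : u ≠ 0) : deRhamCdf u 0 = 0 := by
  have mem := (isUnitCdf_deRhamCdf u).mem_Icc 0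
  have fixed : moebius (deRhamMatrix0 u) (deRhamCdf u 0) = deRhamCdf u 0 :=
    (isDeRhamPair_moebius u).left_limitCdf_zero
  have denom_pos := moebiusDenom_deRhamMatrix0_pos (u := u) mem
  rw [moebiusDenom_deRhamMatrix0] at denom_pos
  rw [moebius_deRhamMatrix0, div_eq_iff denom_pos.ne'] at fixed
  have : 0 < u ^ 2 * xParam u ^ 2 := by have := xParam_pos u; positivity
  have : 0 < 1 - xParam u := by linarith [xParam_quadratic u]
  by_contra hne
  have : xParam u = 1 - (1 - xParam u) / 2 * deRhamCdf u 0 := mul_left_cancel₀ hne (by linarith)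
  nlinarith [mem.2]

lemma satisfiesDeRham_deRhamCdf (hu : u ≠ 0) : SatisfiesDeRham u (deRhamCdf u) := by
  have mem := (isUnitCdf_deRhamCdf u).mem_Icc
  exact ⟨fun y hy => ⟨(moebiusDenom_deRhamMatrix0_pos (mem _)).ne',
      (isDeRhamPair_moebius u).limitCdf_of_le_half (deRhamCdf_zero hu) hy.2⟩,
    fun y hy => ⟨(moebiusDenom_deRhamMatrix1_pos (mem _)).ne',
      (isDeRhamPair_moebius u).limitCdf_of_half_le hy.1⟩⟩

lemma deRhamCdf_zero_left : deRhamCdf 0 = (Ici 0).indicator 1 := by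
  have fixed : deRhamStep (moebius (deRhamMatrix0 0)) (moebius (deRhamMatrix1 0))
      ((Ici 0).indicator 1) = (Ici 0).indicator 1 := by
    funext y
    simp only [deRhamStep, moebius_deRhamMatrix0, moebius_deRhamMatrix1, xParam_zero]
    split_ifs with hy
    · simp [indicator_apply]
    · simp [show 0 ≤ y by linarith]
  funext y
  simp only [deRhamCdf, limitCdf, approxCdf, Function.iterate_fixed fixed, ciInf_const]

end Parameter

section AbsoluteContinuity

lemma absolutelyContinuous_of_lipschitzWith {f : StieltjesFunction ℝ} {K : NNReal}
    (hf : LipschitzWith K f) : f.measure ≪ volume := by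
  have sub_le {y z : ℝ} (hyz : y ≤ z) : f z - f y ≤ K * (z - y) := by
    have := (le_abs_self _).trans (hf.dist_le_mul z y)
    rwa [Real.dist_eq, abs_of_nonneg (sub_nonneg.2 hyz)] at this
  let complement : StieltjesFunction ℝ :=
    { toFun := fun y => K * y - f y
      mono' := fun y z hyz => by dsimp only; linarith [sub_le hyz]
      right_continuous' := fun y => ContinuousWithinAt.sub (by fun_prop) (f.right_continuous y) }
  have sum_eq : f + complement = K • StieltjesFunction.id := by
    ext y
    exact add_sub_cancel (f y) (K * y)
  have measure_sum_eq : f.measure + complement.measure = K • volume := by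
    rw [← StieltjesFunction.measure_add, sum_eq, StieltjesFunction.measure_smul,
      Real.volume_eq_stieltjes_id]
  have measure_le : f.measure ≤ K • volume := measure_sum_eq ▸ Measure.le_add_right le_rfl
  exact (Measure.absolutelyContinuous_of_le measure_le).trans Measure.smul_absolutelyContinuous

lemma IsUnitCdf.law_absolutelyContinuous {F : ℝ → ℝ} (hF : IsUnitCdf F) (h0 : F 0 = 0)
    {K : NNReal} (hK : LipschitzOnWith K F (Icc 0 1)) :
    (hF.law : Measure ℝ) ≪ volume.restrict (Icc 0 1) := by
  have clamp_eq : IccExtend (zero_le_one' ℝ) ((Icc 0 1).domRestrict F) = F := by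
    funext y
    rcases lt_or_ge y 0 with hy | hy
    · simp [IccExtend_of_le_left _ _ hy.le, h0, hF.of_neg hy]
    rcases le_or_gt 1 y with hy1 | hy1
    · simp [IccExtend_of_right_le _ _ hy1, hF.of_one_le le_rfl, hF.of_one_le hy1]
    · simp [IccExtend_of_mem _ _ ⟨hy, hy1.le⟩]
  have lipschitz : LipschitzWith K hF.stieltjes := by
    change LipschitzWith K F
    rw [← clamp_eq, ← mul_one K]
    exact hK.to_restrict.comp (LipschitzWith.projIcc (zero_le_one' ℝ))
  have concentrated : ∀ᵐ y ∂(hF.law : Measure ℝ), y ∈ Icc (0 : ℝ) 1 :=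
    (prob_compl_eq_zero_iff measurableSet_Icc).2 hF.law_Icc
  rw [← Measure.restrict_eq_self_of_ae_mem concentrated]
  exact (absolutelyContinuous_of_lipschitzWith lipschitz).restrict (Icc 0 1)

/-- The distance of two solutions shrinks by the factor `K` with each dyadic scale. -/
lemma eqOn_of_deRhamStep {g₀ g₁ F G : ℝ → ℝ} {K : NNReal} (hK : K < 1)
    (hg₀ : LipschitzOnWith K g₀ (Icc 0 1)) (hg₁ : LipschitzOnWith K g₁ (Icc 0 1))
    (hF : MapsTo F (Icc 0 1) (Icc 0 1)) (hG : MapsTo G (Icc 0 1) (Icc 0 1))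
    (hF' : EqOn F (deRhamStep g₀ g₁ F) (Icc 0 1))
    (hG' : EqOn G (deRhamStep g₀ g₁ G) (Icc 0 1)) : EqOn F G (Icc 0 1) := by
  have dist_le (n : ℕ) : ∀ y ∈ Icc (0 : ℝ) 1, dist (F y) (G y) ≤ K ^ n := by
    induction n with
    | zero => exact fun y hy => by simpa using Real.dist_le_of_mem_Icc (hF hy) (hG hy)
    | succ n ih =>
      have contract {g : ℝ → ℝ} (hg : LipschitzOnWith K g (Icc 0 1)) {z : ℝ}
          (hz : z ∈ Icc (0 : ℝ) 1) : dist (g (F z)) (g (G z)) ≤ K ^ (n + 1) :=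
        (hg.dist_le_mul _ (hF hz) _ (hG hz)).trans <| by
          rw [pow_succ']
          exact mul_le_mul_of_nonneg_left (ih z hz) K.2
      intro y hy
      rw [hF' hy, hG' hy, deRhamStep, deRhamStep]
      split_ifs with h
      · exact contract hg₀ ⟨by linarith [hy.1], by linarith⟩
      · exact contract hg₁ ⟨by linarith, by linarith [hy.2]⟩
  intro y hy
  refine dist_le_zero.1 (ge_of_tendsto' (tendsto_pow_atTop_nhds_zero_of_lt_one K.2 hK)
    fun n => dist_le n y hy)

/-- At `u = 1` the map `y ↦ 2 y / (1 + y)` conjugates the two Möbius maps to `y / 2` and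
`(1 + y) / 2`. -/
lemma deRhamCdf_one : EqOn (deRhamCdf 1) (fun y => 2 * y / (1 + y)) (Icc 0 1) := by
  have hx : xParam 1 = 1 / 2 := (xParam_eq_half_iff zero_le_one).2 rfl
  have solution_mem : MapsTo (fun y : ℝ => 2 * y / (1 + y)) (Icc 0 1) (Icc 0 1) := fun y hy => by
    have hden : 0 < 1 + y := by linarith [hy.1]
    exact ⟨div_nonneg (by linarith [hy.1]) hden.le, (div_le_one hden).2 (by linarith [hy.2])⟩
  refine eqOn_of_deRhamStep (K := 8 / 9) (by rw [div_lt_one] <;> norm_num)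
    (lipschitzOnWith_moebius (δ := 3 / 4) (by norm_num) (fun z hz => ?_) ?_)
    (lipschitzOnWith_moebius (δ := 1 / 2) (by norm_num) (fun z hz => ?_) ?_)
    (fun y _ => (isUnitCdf_deRhamCdf 1).mem_Icc y) solution_mem
    (fun y _ => (congrFun (isDeRhamPair_moebius 1).deRhamStep_limitCdf y).symm) fun y hy => ?_
  · exact le_trans (by rw [hx]; norm_num) (le_moebiusDenom_deRhamMatrix0 hz)
  · rw [det_deRhamMatrix0, hx]
    norm_num
  · exact le_trans hx.ge (le_moebiusDenom_deRhamMatrix1 hz)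
  · rw [det_deRhamMatrix1, hx]
    norm_num
  · have hy0 := hy.1
    simp only [deRhamStep, moebius_deRhamMatrix0, moebius_deRhamMatrix1, hx]
    split_ifs with h
    · rw [show 1 - (1 - 1 / 2) / 2 * (2 * (2 * y) / (1 + 2 * y)) = (1 + y) / (1 + 2 * y) by
        field_simp; ring]
      field_simp
    · have : 0 < y := by linarith
      rw [show 1 - (1 - 1 / 2) / 2 * (1 + 2 * (2 * y - 1) / (1 + (2 * y - 1))) =
        (1 + y) / (4 * y) by rw [add_sub_cancel]; field_simp; ring]
      field_simp
      norm_num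

lemma law_deRhamCdf_one_absolutelyContinuous :
    ((isUnitCdf_deRhamCdf 1).law : Measure ℝ) ≪ volume.restrict (Icc 0 1) := by
  refine (isUnitCdf_deRhamCdf 1).law_absolutelyContinuous (deRhamCdf_zero one_ne_zero) (K := 2)
    (LipschitzOnWith.of_dist_le_mul fun y hy z hz => ?_)
  have hy0 := hy.1
  have hz0 := hz.1
  rw [deRhamCdf_one hy, deRhamCdf_one hz, Real.dist_eq, Real.dist_eq,
    show 2 * y / (1 + y) - 2 * z / (1 + z) = 2 * (y - z) / ((1 + y) * (1 + z)) by field_simp; ring,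
    abs_div, abs_mul, abs_two, abs_of_pos (show 0 < (1 + y) * (1 + z) by positivity)]
  exact div_le_self (by positivity) (by nlinarith [mul_nonneg hy0 hz0])

end AbsoluteContinuity

section Singularity

lemma IsUnitCdf.law_mutuallySingular {F : ℝ → ℝ} (hF : IsUnitCdf F)
    (hderiv : ∀ t ∈ Ioo (0 : ℝ) 1, ∀ d, HasDerivAt F d t → d = 0) :
    (hF.law : Measure ℝ) ⟂ₘ volume.restrict (Icc 0 1) := by
  suffices hF.stieltjes.measure ⟂ₘ volume from
    this.mono_ac .rfl Measure.absolutelyContinuous_restrict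
  rw [← Measure.rnDeriv_eq_zero]
  filter_upwards [hF.stieltjes.ae_hasDerivAt,
    Measure.rnDeriv_lt_top hF.stieltjes.measure volume, Measure.ae_ne volume (0 : ℝ),
    Measure.ae_ne volume (1 : ℝ)] with t ht hfin ht0 ht1
  change HasDerivAt F _ t at ht
  suffices (hF.stieltjes.measure.rnDeriv volume t).toReal = 0 from
    ((ENNReal.toReal_eq_zero_iff _).1 this).resolve_right hfin.ne
  rcases ht0.lt_or_gt with hneg | hpos
  · refine ht.unique ((hasDerivAt_const t (0 : ℝ)).congr_of_eventuallyEq ?_)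
    filter_upwards [Iio_mem_nhds hneg] with y hy using hF.of_neg hy
  rcases ht1.lt_or_gt with hlt | hgt
  · exact hderiv t ⟨hpos, hlt⟩ _ ht
  · refine ht.unique ((hasDerivAt_const t (1 : ℝ)).congr_of_eventuallyEq ?_)
    filter_upwards [Ioi_mem_nhds hgt] with y hy using hF.of_one_le (mem_Ioi.1 hy).le

lemma tendsto_slope_of_abs_sub_le {f : ℝ → ℝ} {d t : ℝ} (hf : HasDerivAt f d t) {a h : ℕ → ℝ}
    (hpos : ∀ n, 0 < h n) (hlim : Tendsto h atTop (𝓝 0)) (ha : ∀ n, |a n - t| ≤ h n) (c : ℝ) :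
    Tendsto (fun n => (f (a n + c * h n) - f (a n)) / h n) atTop (𝓝 (c * d)) := by
  have isLittleO_remainder (c : ℝ) :
      (fun n => f (a n + c * h n) - f t - (a n + c * h n - t) • d) =o[atTop] h := by
    have isBigO_sub : (fun n => a n + c * h n - t) =O[atTop] h := by
      refine Asymptotics.IsBigO.of_bound (1 + |c|) (Eventually.of_forall fun n => ?_)
      rw [Real.norm_eq_abs, Real.norm_eq_abs, abs_of_pos (hpos n),
        show a n + c * h n - t = (a n - t) + c * h n by ring]
      calc
        |a n - t + c * h n| ≤ |a n - t| + |c| * h n := by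
          simpa only [abs_mul, abs_of_pos (hpos n)] using abs_add_le (a n - t) (c * h n)
        _ ≤ (1 + |c|) * h n := by linarith [ha n]
    have tendsto_point : Tendsto (fun n => a n + c * h n) atTop (𝓝 t) := by
      simpa using (isBigO_sub.trans_tendsto hlim).add_const t
    exact ((hasDerivAt_iff_isLittleO.1 hf).comp_tendsto tendsto_point).trans_isBigO isBigO_sub
  have tendsto_remainder :=
    ((isLittleO_remainder c).sub (isLittleO_remainder 0)).tendsto_div_nhds_zero
  rw [← zero_add (c * d)]
  refine (tendsto_remainder.add_const (c * d)).congr fun n => ?_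
  have := (hpos n).ne'
  simp only [smul_eq_mul, zero_mul, add_zero]
  field_simp
  ring

/-- The cross ratio of the values of `f` at the points of `[a, a + h]` with relative positions
`0`, `1/4`, `1/2` and `1`. -/
noncomputable def quarterCrossRatio (f : ℝ → ℝ) (a h : ℝ) : ℝ :=
  crossRatio (f a) (f (a + 1 / 4 * h)) (f (a + 1 / 2 * h)) (f (a + 1 * h))

lemma quarterCrossRatio_of_moebius {A : Matrix (Fin 2) (Fin 2) ℝ} (hdet : A.det ≠ 0) {f : ℝ → ℝ}
    {a h b k : ℝ} (hf : ∀ c ∈ Icc (0 : ℝ) 1, moebiusDenom A (f (a + c * h)) ≠ 0 ∧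
      f (b + c * k) = moebius A (f (a + c * h))) :
    quarterCrossRatio f b k = quarterCrossRatio f a h := by
  obtain ⟨d₀, e₀⟩ := hf 0 (by norm_num)
  obtain ⟨d₁, e₁⟩ := hf (1 / 4) (by norm_num)
  obtain ⟨d₂, e₂⟩ := hf (1 / 2) (by norm_num)
  obtain ⟨d₃, e₃⟩ := hf 1 (by norm_num)
  simp only [zero_mul, add_zero] at d₀ e₀
  rw [quarterCrossRatio, e₀, e₁, e₂, e₃]
  exact crossRatio_moebius hdet d₀ d₁ d₂ d₃

lemma tendsto_quarterCrossRatio {f : ℝ → ℝ} {d t : ℝ} (hf : HasDerivAt f d t) (hd : d ≠ 0)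
    {a h : ℕ → ℝ} (hpos : ∀ n, 0 < h n) (hlim : Tendsto h atTop (𝓝 0))
    (ha : ∀ n, |a n - t| ≤ h n) :
    Tendsto (fun n => quarterCrossRatio f (a n) (h n)) atTop (𝓝 (1 / 2)) := by
  have slope := tendsto_slope_of_abs_sub_le hf hpos hlim ha
  have limit_eq : crossRatio 0 (1 / 4 * d) (1 / 2 * d) (1 * d) = 1 / 2 := by
    unfold crossRatio
    field_simp
    ring
  rw [← limit_eq]
  refine Tendsto.congr (fun n => crossRatio_sub_div (hpos n).ne') ?_
  refine Tendsto.div (((slope _).sub_const 0).mul ((slope _).sub (slope _)))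
    (((slope _).sub (slope _)).mul ((slope _).sub_const 0)) ?_
  rw [← sub_mul, sub_zero]
  norm_num [hd]

namespace SatisfiesDeRham

variable {u : ℝ} {f : ℝ → ℝ}

lemma quarterCrossRatio_unit (hf : SatisfiesDeRham u f) (hu : u ≠ 0) (h0 : f 0 = 0)
    (h1 : f 1 = 1) : quarterCrossRatio f 0 1 = xParam u := by
  have hx := xParam_pos u
  have hx1 : 1 - xParam u ≠ 0 := by
    have : 0 < u ^ 2 * xParam u ^ 2 := by positivity
    linarith [xParam_quadratic u]
  have at_half : f (1 / 2) = 2 * xParam u / (1 + xParam u) := by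
    rw [(hf.1 (1 / 2) (by norm_num)).2, mul_one_div_cancel two_ne_zero, h1, moebius_deRhamMatrix0,
      show 1 - (1 - xParam u) / 2 * 1 = (1 + xParam u) / 2 by ring]
    field_simp
  have at_quarter : f (1 / 4) = 2 * xParam u ^ 2 / (1 + xParam u ^ 2) := by
    rw [(hf.1 (1 / 4) (by norm_num)).2, show (2 : ℝ) * (1 / 4) = 1 / 2 by norm_num, at_half,
      moebius_deRhamMatrix0, show 1 - (1 - xParam u) / 2 * (2 * xParam u / (1 + xParam u)) =
        (1 + xParam u ^ 2) / (1 + xParam u) by field_simp; ring]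
    field_simp
  have half_sub_quarter : f (1 / 2) - f (1 / 4) =
      2 * xParam u * (1 - xParam u) / ((1 + xParam u) * (1 + xParam u ^ 2)) := by
    rw [at_half, at_quarter]
    field_simp
    ring
  simp only [quarterCrossRatio, crossRatio, zero_add, mul_one, h0, h1, sub_zero]
  rw [half_sub_quarter, at_quarter, at_half]
  field_simp
  ring

lemma quarterCrossRatio_left (hf : SatisfiesDeRham u f) {a h : ℝ} (ha : 0 ≤ a)
    (hh : 0 ≤ h) (hah : a + h ≤ 1) :
    quarterCrossRatio f (a / 2) (h / 2) = quarterCrossRatio f a h := by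
  refine quarterCrossRatio_of_moebius (det_deRhamMatrix0 u ▸ (xParam_pos u).ne') fun c hc => ?_
  have hc0 : 0 ≤ c * h := mul_nonneg hc.1 hh
  have hc1 : c * h ≤ h := mul_le_of_le_one_left hh hc.2
  have branch := hf.1 ((a + c * h) / 2) ⟨by linarith, by linarith⟩
  rwa [mul_div_cancel₀ _ two_ne_zero, add_div, mul_div_assoc] at branch

lemma quarterCrossRatio_right (hf : SatisfiesDeRham u f) (hu : u ≠ 0) {a h : ℝ} (ha : 0 ≤ a)
    (hh : 0 ≤ h) (hah : a + h ≤ 1) :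
    quarterCrossRatio f ((1 + a) / 2) (h / 2) = quarterCrossRatio f a h := by
  have hdet : (deRhamMatrix1 u).det ≠ 0 := by
    have := xParam_pos u
    rw [det_deRhamMatrix1]
    positivity
  refine quarterCrossRatio_of_moebius hdet fun c hc => ?_
  have hc0 : 0 ≤ c * h := mul_nonneg hc.1 hh
  have hc1 : c * h ≤ h := mul_le_of_le_one_left hh hc.2
  have branch := hf.2 ((1 + (a + c * h)) / 2) ⟨by linarith, by linarith⟩
  rwa [mul_div_cancel₀ _ two_ne_zero, add_sub_cancel_left, ← add_assoc, add_div, mul_div_assoc]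
    at branch

lemma quarterCrossRatio_dyadic (hf : SatisfiesDeRham u f) (hu : u ≠ 0) (h0 : f 0 = 0)
    (h1 : f 1 = 1) (n : ℕ) {k : ℕ} (hk : k < 2 ^ n) :
    quarterCrossRatio f (k / 2 ^ n) (1 / 2 ^ n) = xParam u := by
  induction n generalizing k with
  | zero => simpa [Nat.lt_one_iff.1 hk] using hf.quarterCrossRatio_unit hu h0 h1
  | succ n ih =>
    have interval {j : ℕ} (hj : j < 2 ^ n) : (j : ℝ) / 2 ^ n + 1 / 2 ^ n ≤ 1 := by
      rw [← add_div, div_le_one (by positivity)]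
      exact_mod_cast hj
    have mesh_eq : (1 : ℝ) / 2 ^ (n + 1) = 1 / 2 ^ n / 2 := by rw [pow_succ, div_div]
    rcases lt_or_ge k (2 ^ n) with hkn | hkn
    · rw [mesh_eq, pow_succ, ← div_div, hf.quarterCrossRatio_left (by positivity) (by positivity)
        (interval hkn), ih hkn]
    · obtain ⟨j, rfl⟩ := Nat.exists_eq_add_of_le hkn
      have hj : j < 2 ^ n := by rw [pow_succ] at hk; lia
      rw [mesh_eq, show ((2 ^ n + j : ℕ) : ℝ) / 2 ^ (n + 1) = (1 + j / 2 ^ n) / 2 by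
          push_cast; field_simp; ring, hf.quarterCrossRatio_right hu (by positivity) (by positivity)
        (interval hj), ih hj]

lemma deriv_eq_zero (hf : SatisfiesDeRham u f) (hu : u ≠ 0) (hx : xParam u ≠ 1 / 2) (h0 : f 0 = 0)
    (h1 : f 1 = 1) {t : ℝ} (ht : t ∈ Ico (0 : ℝ) 1) {d : ℝ} (hd : HasDerivAt f d t) : d = 0 := by
  by_contra hne
  have floor_bounds (n : ℕ) : (⌊t * 2 ^ n⌋₊ : ℝ) ≤ t * 2 ^ n ∧ t * 2 ^ n < ⌊t * 2 ^ n⌋₊ + 1 :=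
    ⟨Nat.floor_le (mul_nonneg ht.1 (by positivity)), Nat.lt_floor_add_one _⟩
  have close (n : ℕ) : |(⌊t * 2 ^ n⌋₊ : ℝ) / 2 ^ n - t| ≤ 1 / 2 ^ n := by
    obtain ⟨hle, hlt⟩ := floor_bounds n
    rw [div_sub' (by positivity), abs_div, abs_of_pos (by positivity : (0 : ℝ) < 2 ^ n)]
    gcongr
    rw [abs_le]
    constructor <;> linarith
  have const (n : ℕ) : quarterCrossRatio f (⌊t * 2 ^ n⌋₊ / 2 ^ n) (1 / 2 ^ n) = xParam u := by
    refine hf.quarterCrossRatio_dyadic hu h0 h1 n ?_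
    have : (⌊t * 2 ^ n⌋₊ : ℝ) < 2 ^ n :=
      (floor_bounds n).1.trans_lt (mul_lt_of_lt_one_left (by positivity) ht.2)
    exact_mod_cast this
  have mesh : Tendsto (fun n : ℕ => 1 / (2 : ℝ) ^ n) atTop (𝓝 0) := by
    simpa only [one_div_pow] using
      tendsto_pow_atTop_nhds_zero_of_lt_one (r := (1 / 2 : ℝ)) (by norm_num) (by norm_num)
  have lim := tendsto_quarterCrossRatio hd hne (fun n => by positivity) mesh close
  simp only [const] at lim
  exact hx (tendsto_nhds_unique tendsto_const_nhds lim)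

end SatisfiesDeRham

lemma law_deRhamCdf_mutuallySingular {u : ℝ} (hx : xParam u ≠ 1 / 2) :
    ((isUnitCdf_deRhamCdf u).law : Measure ℝ) ⟂ₘ volume.restrict (Icc 0 1) := by
  refine (isUnitCdf_deRhamCdf u).law_mutuallySingular fun t ht d hd => ?_
  rcases eq_or_ne u 0 with rfl | hu
  · rw [deRhamCdf_zero_left] at hd
    refine hd.unique ((hasDerivAt_const t (1 : ℝ)).congr_of_eventuallyEq ?_)
    filter_upwards [Ioi_mem_nhds ht.1] with y hy
    exact indicator_of_mem (mem_Ici.2 (mem_Ioi.1 hy).le) 1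
  · exact (satisfiesDeRham_deRhamCdf hu).deriv_eq_zero hu hx (deRhamCdf_zero hu)
      ((isUnitCdf_deRhamCdf u).of_one_le le_rfl) (Ioo_subset_Ico_self ht) hd

end Singularity

lemma tendsto_probabilityMeasure_of_tendsto_cdf {ι : Type*} {l : Filter ι}
    [l.IsCountablyGenerated] {μs : ι → ProbabilityMeasure ℝ} {μ : ProbabilityMeasure ℝ}
    (h : ∀ y, Tendsto (fun i => cdf (μs i : Measure ℝ) y) l (𝓝 (cdf (μ : Measure ℝ) y))) :
    Tendsto μs l (𝓝 μ) := by
  have measure_Ioc (ν : ProbabilityMeasure ℝ) (a b : ℝ) :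
      ν (Ioc a b) = (cdf (ν : Measure ℝ) b - cdf (ν : Measure ℝ) a).toNNReal := by
    rw [← ENNReal.coe_inj, ProbabilityMeasure.ennreal_coeFn_eq_coeFn_toMeasure,
      ← measure_cdf (ν : Measure ℝ), StieltjesFunction.measure_Ioc, measure_cdf]
    rfl
  refine (isPiSystem_Ioc (id : ℝ → ℝ) id).tendsto_probabilityMeasure_of_tendsto_of_mem ?_ ?_ ?_
  · rintro _ ⟨a, b, -, rfl⟩
    exact measurableSet_Ioc
  · intro s hs y hy
    obtain ⟨ε, hε, ball_subset⟩ := Metric.isOpen_iff.1 hs y hy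
    refine ⟨Ioc (y - ε / 2) (y + ε / 2), ⟨_, _, by simp only [id]; linarith, rfl⟩,
      Ioc_mem_nhds (by linarith) (by linarith), fun z hz => ball_subset ?_⟩
    rw [Metric.mem_ball, Real.dist_eq, abs_lt]
    constructor <;> linarith [hz.1, hz.2]
  · rintro _ ⟨a, b, -, rfl⟩
    simp_rw [measure_Ioc]
    exact (continuous_real_toNNReal.tendsto _).comp ((h _).sub (h _))

section FirstPassage

/-- The list of steps of a path, multiplied by a sign. -/
def signed (e : ℤˣ) (l : List ℤ) : List ℤ := l.map fun s => (e : ℤ) * s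

/-- All steps of the list are `±1`. -/
def IsSteps (l : List ℤ) : Prop := ∀ s ∈ l, |s| = 1

/-- The set of points that the path with the given steps visits before its last time. -/
def visited (l : List ℤ) : Set ℤ := {z | ∃ i < l.length, (l.take i).sum = z}

/-- The path with the given steps ends at `h`, when it leaves `(-h, h)` for the first time. -/
structure FirstPassage (h : ℤ) (l : List ℤ) : Prop where
  isSteps : IsSteps l
  sum_eq : l.sum = h
  abs_lt : ∀ i < l.length, |(l.take i).sum| < h

variable {h : ℤ} {e : ℤˣ} {l p q r : List ℤ}

@[simp] lemma signed_length (e : ℤˣ) (l : List ℤ) : (signed e l).length = l.length := by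
  simp [signed]

@[simp] lemma signed_one (l : List ℤ) : signed 1 l = l := by simp [signed]

@[simp] lemma signed_append (e : ℤˣ) (l r : List ℤ) :
    signed e (l ++ r) = signed e l ++ signed e r := by simp [signed]

@[simp] lemma signed_signed (e f : ℤˣ) (l : List ℤ) :
    signed e (signed f l) = signed (e * f) l := by
  simp [signed, mul_assoc]

lemma signed_self (e : ℤˣ) (l : List ℤ) : signed e (signed e l) = l := by
  simp [Int.units_mul_self]

@[simp] lemma signed_sum (e : ℤˣ) (l : List ℤ) : (signed e l).sum = e * l.sum := by
  simpa [signed] using List.sum_map_mul_left l id (e : ℤ)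

@[simp] lemma signed_take (e : ℤˣ) (l : List ℤ) (i : ℕ) :
    (signed e l).take i = signed e (l.take i) := by simp [signed, List.map_take]

lemma abs_unit_mul (e : ℤˣ) (z : ℤ) : |(e : ℤ) * z| = |z| := by
  rw [abs_mul, Int.abs_eq_natAbs (e : ℤ), Int.units_natAbs, Nat.cast_one, one_mul]

lemma isSteps_signed (hl : IsSteps l) (e : ℤˣ) : IsSteps (signed e l) := by
  intro s hs
  obtain ⟨z, hz, rfl⟩ := List.mem_map.1 hs
  rw [abs_unit_mul]
  exact hl z hz

lemma isSteps_append : IsSteps (l ++ r) ↔ IsSteps l ∧ IsSteps r := by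
  simp [IsSteps, or_imp, forall_and]

lemma mem_visited_append {z : ℤ} :
    z ∈ visited (l ++ r) ↔ z ∈ visited l ∨ z - l.sum ∈ visited r := by
  constructor
  · rintro ⟨i, hi, rfl⟩
    rcases lt_or_ge i l.length with h | h
    · exact Or.inl ⟨i, h, by rw [List.take_append_of_le_length h.le]⟩
    · obtain ⟨j, rfl⟩ := Nat.exists_eq_add_of_le h
      rw [List.length_append, add_lt_add_iff_left] at hi
      exact Or.inr ⟨j, hi, by simp [List.take_length_add_append]⟩
  · rintro (⟨i, hi, rfl⟩ | ⟨i, hi, hz⟩)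
    · exact ⟨i, by rw [List.length_append]; omega, by rw [List.take_append_of_le_length hi.le]⟩
    · exact ⟨l.length + i, by rw [List.length_append]; omega, by
        rw [List.take_length_add_append, List.sum_append, hz, add_sub_cancel]⟩

lemma mem_visited_signed {z : ℤ} : z ∈ visited (signed e l) ↔ e * z ∈ visited l := by
  have mul_eq_comm (y : ℤ) : e * y = z ↔ y = e * z := by
    rcases Int.units_eq_one_or e with rfl | rfl
    · simp
    · simp [neg_eq_iff_eq_neg]
  simp only [visited, mem_ofPred_eq, signed_length, signed_take, signed_sum, mul_eq_comm]

lemma IsSteps.exists_first_abs_sum_eq (hh : 0 < h) (hl : IsSteps l) (hsum : h ≤ |l.sum|) :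
    ∃ k ≤ l.length, |(l.take k).sum| = h ∧ ∀ j < k, |(l.take j).sum| < h := by
  classical
  have reached : ∃ i, h ≤ |(l.take i).sum| := ⟨l.length, by rwa [List.take_length]⟩
  obtain ⟨m, hm⟩ : ∃ m, Nat.find reached = m + 1 := Nat.exists_eq_succ_of_ne_zero fun h0 => by
    have h1 := Nat.find_spec reached
    rw [h0, List.take_zero, List.sum_nil, abs_zero] at h1
    omega
  have reached_succ : h ≤ |(l.take (m + 1)).sum| := hm ▸ Nat.find_spec reached
  have not_reached : ∀ j < m + 1, |(l.take j).sum| < h := fun j hj =>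
    not_le.1 (Nat.find_min reached (hm ▸ hj))
  have m_lt : m < l.length := by
    by_contra! hle
    have h1 := not_reached m m.lt_succ_self
    rw [List.take_of_length_le (by omega)] at h1 reached_succ
    omega
  have sum_succ : |(l.take (m + 1)).sum| ≤ |(l.take m).sum| + 1 := by
    rw [List.sum_take_succ _ _ m_lt, ← hl _ (List.getElem_mem m_lt)]
    exact abs_add_le _ _
  exact ⟨m + 1, m_lt, by linarith [not_reached m m.lt_succ_self], not_reached⟩

lemma IsSteps.exists_firstPassage (hh : 0 < h) (hl : IsSteps l) (hsum : h ≤ |l.sum|) :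
    ∃ (e : ℤˣ) (p r : List ℤ), FirstPassage h p ∧ l = signed e p ++ r := by
  obtain ⟨k, hk, sum_k, sum_lt⟩ := hl.exists_first_abs_sum_eq hh hsum
  obtain ⟨e, he⟩ : ∃ e : ℤˣ, (e : ℤ) * (l.take k).sum = h := by
    rcases (abs_eq hh.le).1 sum_k with h1 | h1
    · exact ⟨1, by simp [h1]⟩
    · exact ⟨-1, by simp [h1]⟩
  refine ⟨e, signed e (l.take k), l.drop k, ⟨?_, ?_, fun j hj => ?_⟩, ?_⟩
  · exact isSteps_signed (fun s hs => hl s (List.mem_of_mem_take hs)) e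
  · rw [signed_sum, he]
  · rw [signed_length, List.length_take, min_eq_left hk] at hj
    rw [signed_take, signed_sum, abs_unit_mul, List.take_take, min_eq_left hj.le]
    exact sum_lt j hj
  · rw [signed_self, List.take_append_drop]

namespace FirstPassage

lemma length_le_of_append_eq (hh : 0 < h) (hp : FirstPassage h p) (hq : FirstPassage h q)
    {f : ℤˣ} {s : List ℤ} (heq : signed e p ++ r = signed f q ++ s) : q.length ≤ p.length := by
  by_contra! hlt
  have take_eq := congrArg (List.take p.length) heq
  rw [List.take_append_of_le_length (by simp),
    List.take_append_of_le_length (by simpa using hlt.le),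
    signed_take, signed_take, List.take_length] at take_eq
  have abs_eq := congrArg (fun l => |List.sum l|) take_eq
  simp only [signed_sum, abs_unit_mul, hp.sum_eq, abs_of_pos hh] at abs_eq
  exact (hq.abs_lt _ hlt).ne' abs_eq

lemma append_inj (hh : 0 < h) (hp : FirstPassage h p) (hq : FirstPassage h q)
    {f : ℤˣ} {s : List ℤ} (heq : signed e p ++ r = signed f q ++ s) : e = f ∧ p = q ∧ r = s := by
  have length_eq : p.length = q.length :=
    (hq.length_le_of_append_eq hh hp heq.symm).antisymm (hp.length_le_of_append_eq hh hq heq)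
  obtain ⟨signed_eq, rfl⟩ := List.append_inj heq (by simpa using length_eq)
  have sum_eq := congrArg List.sum signed_eq
  rw [signed_sum, signed_sum, hp.sum_eq, hq.sum_eq] at sum_eq
  obtain rfl : e = f := Units.ext (mul_right_cancel₀ hh.ne' sum_eq)
  exact ⟨rfl, by rw [← signed_self e p, signed_eq, signed_self], rfl⟩

lemma eq_singleton (hl : FirstPassage 1 l) : l = [1] := by
  match l, hl with
  | [], hl => exact absurd hl.sum_eq (by simp)
  | [s], hl => rw [← hl.sum_eq, List.sum_singleton]
  | s :: s' :: l, hl =>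
    have abs_lt_one : |s| < 1 := by simpa using hl.abs_lt 1 (by simp)
    exact absurd (hl.isSteps s (by simp)) abs_lt_one.ne

lemma abs_sum_append_lt (hl : FirstPassage h (p ++ r)) {i : ℕ} (hi : i < r.length) :
    |p.sum + (r.take i).sum| < h := by
  have h1 := hl.abs_lt (p.length + i) (by simpa using hi)
  rwa [List.take_length_add_append, List.sum_append] at h1

lemma of_opposite_passages (hp : p.sum = h) (hq : q.sum = h)
    (hl : FirstPassage (2 * h) (signed e p ++ (signed (-e) q ++ r))) : FirstPassage (2 * h) r := by
  rw [← List.append_assoc] at hl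
  have sum_zero : (signed e p ++ signed (-e) q).sum = 0 := by simp [hp, hq]
  refine ⟨(isSteps_append.1 hl.isSteps).2, ?_, fun i hi => ?_⟩
  · simpa only [List.sum_append (l₂ := r), sum_zero, zero_add] using hl.sum_eq
  · simpa only [sum_zero, zero_add] using hl.abs_sum_append_lt hi

lemma eq_one_of_equal_passages (hh : 0 < h) (hp : p.sum = h) (hq : q.sum = h)
    (hl : FirstPassage (2 * h) (signed e p ++ (signed e q ++ r))) : e = 1 ∧ r = [] := by
  rw [← List.append_assoc] at hl
  have sum_eq : (signed e p ++ signed e q).sum = e * (2 * h) := by simp [hp, hq, two_mul, mul_add]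
  have nil : r = [] := by
    by_contra hr
    have h1 := hl.abs_sum_append_lt (List.length_pos_iff.2 hr)
    rw [List.take_zero, List.sum_nil, add_zero, sum_eq, abs_unit_mul,
      abs_of_pos (by linarith)] at h1
    exact h1.false
  subst nil
  have h1 := hl.sum_eq
  rw [List.append_nil, sum_eq, mul_eq_right₀ (by linarith)] at h1
  exact ⟨Units.ext h1, rfl⟩

lemma exists_two_passages (hh : 0 < h) (hl : FirstPassage (2 * h) l) :
    ∃ (e f : ℤˣ) (p q r : List ℤ), FirstPassage h p ∧ FirstPassage h q ∧
      l = signed e p ++ (signed f q ++ r) := by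
  obtain ⟨e, p, r, hp, rfl⟩ := hl.isSteps.exists_firstPassage hh (by
    rw [hl.sum_eq, abs_of_pos (by linarith)]; linarith)
  have remaining : h ≤ |r.sum| := by
    have h1 := hl.sum_eq
    rw [List.sum_append, signed_sum, hp.sum_eq] at h1
    have h2 := abs_add_le (e * h) r.sum
    rw [h1, abs_unit_mul, abs_of_pos hh, abs_of_pos (by linarith)] at h2
    linarith
  obtain ⟨f, q, r, hq, rfl⟩ :=
    (isSteps_append.1 hl.isSteps).2.exists_firstPassage hh remaining
  exact ⟨e, f, p, q, r, hp, hq, rfl⟩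

end FirstPassage

end FirstPassage

section PassageTree

/-- The hierarchical decompositions of the paths that first leave `(-2^N, 2^N)` at `2^N`. Such a
path of level `N + 1` consists of excursions to `±2^N` and back to `0`, followed by a passage
from `0` to `2^N` and from there to `2^(N+1)`. -/
inductive PassageTree : ℕ → Type
  | unit : PassageTree 0
  | final {N : ℕ} (a b : PassageTree N) : PassageTree (N + 1)
  | excursion {N : ℕ} (e : ℤˣ) (a b : PassageTree N) (r : PassageTree (N + 1)) :
      PassageTree (N + 1)

namespace PassageTree

variable {N : ℕ}

/-- The list of steps of the path described by a tree. -/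
def steps : {N : ℕ} → PassageTree N → List ℤ
  | _, unit => [1]
  | _, final a b => a.steps ++ b.steps
  | _, excursion e a b r => signed e a.steps ++ (signed (-e) b.steps ++ r.steps)

/-- Minus the minimum of the path described by a tree. -/
def depth : {N : ℕ} → PassageTree N → ℕ
  | _, unit => 0
  | _, final a _ => a.depth
  | _, excursion (N := N) e a b r =>
      if e = 1 then max a.depth r.depth else max (2 ^ N + b.depth) r.depth

lemma depth_lt (t : PassageTree N) : t.depth < 2 ^ N := by
  induction t with
  | unit => simp [depth]
  | final a b iha _ => rw [depth, pow_succ]; omega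
  | excursion e a b r iha ihb ihr =>
    rw [depth]
    rw [pow_succ] at *
    split_ifs <;> omega

lemma isSteps_steps (t : PassageTree N) : IsSteps t.steps := by
  induction t with
  | unit => simp [steps, IsSteps]
  | final a b iha ihb => exact isSteps_append.2 ⟨iha, ihb⟩
  | excursion e a b r iha ihb ihr =>
    exact isSteps_append.2 ⟨isSteps_signed iha e, isSteps_append.2 ⟨isSteps_signed ihb _, ihr⟩⟩

lemma sum_steps (t : PassageTree N) : t.steps.sum = 2 ^ N := by
  induction t with
  | unit => simp [steps]
  | final a b iha ihb => rw [steps, List.sum_append, iha, ihb, pow_succ, mul_two]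
  | excursion e a b r iha ihb ihr =>
    rw [steps, List.sum_append, List.sum_append, signed_sum, signed_sum, iha, ihb, ihr,
      Units.val_neg, neg_mul, add_neg_cancel_left]

lemma visited_steps (t : PassageTree N) :
    visited t.steps = Icc (-(t.depth : ℤ)) (2 ^ N - 1) := by
  induction t with
  | unit =>
    ext z
    simp only [visited, steps, depth, List.length_singleton, Nat.lt_one_iff, exists_eq_left,
      List.take_zero, List.sum_nil, mem_ofPred_eq, mem_Icc]
    omega
  | @final N a b iha ihb =>
    have ha : (a.depth : ℤ) < 2 ^ N := by exact_mod_cast a.depth_lt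
    have hb : (b.depth : ℤ) < 2 ^ N := by exact_mod_cast b.depth_lt
    ext z
    rw [steps, mem_visited_append, iha, ihb, a.sum_steps, mem_Icc, mem_Icc, mem_Icc, depth,
      pow_succ]
    omega
  | @excursion N e a b r iha ihb ihr =>
    have ha : (a.depth : ℤ) < 2 ^ N := by exact_mod_cast a.depth_lt
    have hb : (b.depth : ℤ) < 2 ^ N := by exact_mod_cast b.depth_lt
    have hr : (r.depth : ℤ) < 2 ^ (N + 1) := by exact_mod_cast r.depth_lt
    ext z
    simp only [steps, mem_visited_append, mem_visited_signed, iha, ihb, ihr, signed_sum,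
      a.sum_steps, b.sum_steps, mem_Icc, depth, pow_succ] at hr ⊢
    rcases Int.units_eq_one_or e with rfl | rfl
    · simp only [Units.val_one, Units.val_neg, if_true]
      omega
    · rw [if_neg (by decide)]
      simp only [Units.val_one, Units.val_neg, neg_neg]
      push_cast
      omega

lemma firstPassage_steps (t : PassageTree N) : FirstPassage (2 ^ N) t.steps := by
  refine ⟨t.isSteps_steps, t.sum_steps, fun i hi => abs_lt.2 ?_⟩
  have depth_lt : (t.depth : ℤ) < 2 ^ N := by exact_mod_cast t.depth_lt
  have mem_visited : (t.steps.take i).sum ∈ visited t.steps := ⟨i, hi, rfl⟩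
  rw [visited_steps] at mem_visited
  constructor <;> linarith [mem_visited.1, mem_visited.2]

lemma steps_ne_nil (t : PassageTree N) : t.steps ≠ [] := fun h => by
  have := t.sum_steps
  rw [h, List.sum_nil] at this
  exact absurd this (by positivity)

lemma steps_append_inj {a b : PassageTree N} {e f : ℤˣ} {r s : List ℤ}
    (h : signed e a.steps ++ r = signed f b.steps ++ s) :
    e = f ∧ a.steps = b.steps ∧ r = s :=
  a.firstPassage_steps.append_inj (by positivity) b.firstPassage_steps h

lemma steps_final_ne_steps_excursion {a b a' b' : PassageTree N} {e : ℤˣ}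
    {r : PassageTree (N + 1)} : (final a b).steps ≠ (excursion e a' b' r).steps := by
  intro h
  obtain ⟨rfl, -, h⟩ := steps_append_inj (e := 1) (by simpa only [steps, signed_one] using h)
  obtain ⟨h, -, -⟩ := steps_append_inj (e := 1) (r := [])
    (by simpa only [signed_one, List.append_nil] using h)
  exact absurd h (by decide)

lemma steps_injective : Function.Injective (steps : PassageTree N → List ℤ) := by
  intro t t' h
  induction t with
  | unit => cases t'; rfl
  | final a b iha ihb =>
    cases t' with
    | final a' b' =>
      obtain ⟨-, ha, hb⟩ := steps_append_inj (e := 1) (f := 1)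
        (by simpa only [steps, signed_one] using h)
      rw [iha ha, ihb hb]
    | excursion e' a' b' r' => exact absurd h steps_final_ne_steps_excursion
  | excursion e a b r iha ihb ihr =>
    cases t' with
    | final a' b' => exact absurd h.symm steps_final_ne_steps_excursion
    | excursion e' a' b' r' =>
      obtain ⟨he, ha, h⟩ := steps_append_inj h
      obtain ⟨-, hb, hr⟩ := steps_append_inj h
      rw [he, iha ha, ihb hb, ihr hr]

instance : Countable (PassageTree N) := steps_injective.countable

lemma exists_steps_eq {l : List ℤ} (hl : FirstPassage (2 ^ N) l) :
    ∃ t : PassageTree N, t.steps = l := by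
  induction N generalizing l with
  | zero => exact ⟨unit, hl.eq_singleton.symm⟩
  | succ N ih =>
    induction hn : l.length using Nat.strong_induction_on generalizing l with
    | _ n ihn =>
      subst hn
      rw [pow_succ'] at hl
      obtain ⟨e, f, p, q, r, hp, hq, rfl⟩ := hl.exists_two_passages (by positivity)
      obtain ⟨a, rfl⟩ := ih hp
      obtain ⟨b, rfl⟩ := ih hq
      rcases Int.units_eq_one_or (f * e) with h | h
      · obtain rfl : f = e := by rw [← mul_one f, ← Int.units_mul_self e, ← mul_assoc, h, one_mul]
        obtain ⟨rfl, rfl⟩ := hl.eq_one_of_equal_passages (by positivity) hp.sum_eq hq.sum_eq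
        exact ⟨final a b, by simp [steps]⟩
      · obtain rfl : f = -e := by
          rw [← mul_one f, ← Int.units_mul_self e, ← mul_assoc, h, neg_one_mul]
        have hr := hl.of_opposite_passages hp.sum_eq hq.sum_eq
        have shorter : r.length < (signed e a.steps ++ (signed (-e) b.steps ++ r)).length := by
          have := List.length_pos_iff.2 a.steps_ne_nil
          simp only [List.length_append, signed_length]
          omega
        obtain ⟨t, rfl⟩ := ihn r.length shorter (by rwa [pow_succ']) rfl
        exact ⟨excursion e a b t, rfl⟩

end PassageTree

end PassageTree

section PassageWeight

namespace PassageTree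

variable {N : ℕ}

/-- The probability `P^u_{N,+}({ω})` of the path `ω` described by a tree. -/
noncomputable def weight (u : ℝ) : {N : ℕ} → PassageTree N → ℝ
  | _, unit => 1
  | _, final a b => xParam u * (a.weight u * b.weight u)
  | _, excursion _ a b r => u ^ 2 * xParam u ^ 2 * (a.weight u * b.weight u) * r.weight u

lemma weight_nonneg (u : ℝ) (t : PassageTree N) : 0 ≤ t.weight u := by
  have x_nonneg := (xParam_pos u).le
  induction t with
  | unit => exact zero_le_one
  | final a b iha ihb => exact mul_nonneg x_nonneg (mul_nonneg iha ihb)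
  | excursion _ a b r iha ihb ihr =>
    exact mul_nonneg (mul_nonneg (by positivity) (mul_nonneg iha ihb)) ihr

/-- The weight of a tree as an extended nonnegative real, the form needed for summation over
all trees. -/
noncomputable def mass (u : ℝ) (t : PassageTree N) : ℝ≥0∞ := ENNReal.ofReal (t.weight u)

lemma mass_unit (u : ℝ) : mass u unit = 1 := by simp [mass, weight]

lemma mass_final (u : ℝ) (a b : PassageTree N) :
    mass u (final a b) = ENNReal.ofReal (xParam u) * (mass u a * mass u b) := by
  rw [mass, mass, mass, weight, ENNReal.ofReal_mul (xParam_pos u).le,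
    ENNReal.ofReal_mul (a.weight_nonneg u)]

lemma mass_excursion (u : ℝ) (e : ℤˣ) (a b : PassageTree N) (r : PassageTree (N + 1)) :
    mass u (excursion e a b r) =
      ENNReal.ofReal ((1 - xParam u) / 2) * (mass u a * mass u b) * mass u r := by
  have ha := a.weight_nonneg u
  have hb := b.weight_nonneg u
  rw [mass, mass, mass, mass, weight, ENNReal.ofReal_mul (by positivity),
    ENNReal.ofReal_mul (by positivity), ENNReal.ofReal_mul ha, xParam_quadratic]

/-- The number of excursions to `±2^N` and back before the final passage. -/
def excursionCount : PassageTree (N + 1) → ℕ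
  | final _ _ => 0
  | excursion _ _ _ r => r.excursionCount + 1

/-- A tree is either a final passage or an excursion followed by a tree. -/
def succEquiv (N : ℕ) : PassageTree (N + 1) ≃
    (PassageTree N × PassageTree N) ⊕
      (PassageTree (N + 1) × ℤˣ × PassageTree N × PassageTree N) where
  toFun
    | final a b => Sum.inl (a, b)
    | excursion e a b r => Sum.inr (r, e, a, b)
  invFun
    | Sum.inl (a, b) => final a b
    | Sum.inr (r, e, a, b) => excursion e a b r
  left_inv t := by cases t <;> rfl
  right_inv s := by rcases s with ⟨a, b⟩ | ⟨r, e, a, b⟩ <;> rfl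

lemma tsum_zero_level (g : PassageTree 0 → ℝ≥0∞) : ∑' t, g t = g unit :=
  tsum_eq_single unit fun t ht => absurd (by cases t; rfl) ht

lemma tsum_succ (g : PassageTree (N + 1) → ℝ≥0∞) :
    ∑' t, g t =
      (∑' a, ∑' b, g (final a b)) + ∑' r, ∑' e, ∑' a, ∑' b, g (excursion e a b r) := by
  rw [← (succEquiv N).symm.tsum_eq, ENNReal.summable.tsum_sum (by exact ENNReal.summable)]
  simp only [ENNReal.tsum_prod']
  rfl

section Geometric

variable {g : PassageTree (N + 1) → ℝ≥0∞} {κ : ℤˣ → PassageTree N → PassageTree N → ℝ≥0∞}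

lemma tsum_excursionCount_eq (h : ∀ e a b r, g (excursion e a b r) = κ e a b * g r) (k : ℕ) :
    ∑' t, (if t.excursionCount = k then g t else 0) =
      (∑' a, ∑' b, g (final a b)) * (∑' e, ∑' a, ∑' b, κ e a b) ^ k := by
  induction k with
  | zero =>
    rw [tsum_succ]
    simp only [excursionCount, Nat.add_one_ne_zero, if_true, if_false, tsum_zero, add_zero,
      pow_zero, mul_one]
  | succ k ih =>
    rw [tsum_succ, pow_succ, ← mul_assoc, ← ih]
    simp only [excursionCount, Nat.add_right_cancel_iff, h, Nat.zero_ne_add_one, if_false,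
      tsum_zero, zero_add, ← mul_ite_zero, ENNReal.tsum_mul_right, ENNReal.tsum_mul_left]
    exact mul_comm _ _

/-- A function that is multiplicative over excursions has a geometric series as its sum. -/
lemma tsum_eq_of_multiplicative (h : ∀ e a b r, g (excursion e a b r) = κ e a b * g r)
    {s k : ℝ} (hs : ∑' a, ∑' b, g (final a b) = ENNReal.ofReal s) (hs0 : 0 ≤ s)
    (hk : ∑' e, ∑' a, ∑' b, κ e a b = ENNReal.ofReal k) (hk0 : 0 ≤ k) (hk1 : k < 1) :
    ∑' t, g t = ENNReal.ofReal (s / (1 - k)) :=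
  calc
    ∑' t, g t = ∑' t, ∑' n, if t.excursionCount = n then g t else 0 :=
      tsum_congr fun t => (tsum_ite_eq' t.excursionCount fun _ => g t).symm
    _ = ∑' n, ENNReal.ofReal s * ENNReal.ofReal k ^ n := by
      rw [ENNReal.tsum_comm]
      simp only [tsum_excursionCount_eq h, hs, hk]
    _ = ENNReal.ofReal (s / (1 - k)) := by
      rw [ENNReal.tsum_mul_left, ENNReal.tsum_geometric, ← ENNReal.ofReal_one,
        ← ENNReal.ofReal_sub _ hk0, ← ENNReal.ofReal_inv_of_pos (sub_pos.2 hk1),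
        ← ENNReal.ofReal_mul hs0, div_eq_mul_inv]

end Geometric

lemma tsum_intUnits (f : ℤˣ → ℝ≥0∞) : ∑' e, f e = f 1 + f (-1) := by
  rw [tsum_fintype, show (Finset.univ : Finset ℤˣ) = {1, -1} from rfl,
    Finset.sum_pair (by decide)]

lemma half_one_sub_xParam_nonneg (u : ℝ) : 0 ≤ (1 - xParam u) / 2 := by
  linarith [xParam_le_one u]

lemma tsum_mass (u : ℝ) (N : ℕ) : ∑' t : PassageTree N, mass u t = 1 := by
  have hx := xParam_pos u
  have hc := half_one_sub_xParam_nonneg u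
  induction N with
  | zero => rw [tsum_zero_level, mass_unit]
  | succ N ih =>
    rw [tsum_eq_of_multiplicative (mass_excursion u) (s := xParam u) (k := 1 - xParam u) ?_ hx.le
      ?_ (by linarith) (by linarith), sub_sub_cancel, div_self hx.ne', ENNReal.ofReal_one]
    · simp only [mass_final, ENNReal.tsum_mul_left, ih, mul_one]
    · simp only [tsum_intUnits, ENNReal.tsum_mul_left, ih, mul_one]
      rw [← ENNReal.ofReal_add hc hc, add_halves]

/-- The depth of the path described by a tree of level `N`, in units of `2^N`. -/
noncomputable def relDepth (t : PassageTree N) : ℝ := t.depth / 2 ^ N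

lemma relDepth_nonneg (t : PassageTree N) : 0 ≤ t.relDepth := by unfold relDepth; positivity

lemma relDepth_lt_one (t : PassageTree N) : t.relDepth < 1 := by
  rw [relDepth, div_lt_one (by positivity)]
  exact_mod_cast t.depth_lt

lemma relDepth_final (a b : PassageTree N) : (final a b).relDepth = a.relDepth / 2 := by
  rw [relDepth, relDepth, depth, pow_succ, div_div]

lemma relDepth_excursion_one (a b : PassageTree N) (r : PassageTree (N + 1)) :
    (excursion 1 a b r).relDepth = max (a.relDepth / 2) r.relDepth := by
  rw [relDepth, relDepth, relDepth, depth, if_pos rfl, Nat.cast_max, div_div, ← pow_succ,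
    max_div_div_right (by positivity)]

lemma relDepth_excursion_neg_one (a b : PassageTree N) (r : PassageTree (N + 1)) :
    (excursion (-1) a b r).relDepth = max ((1 + b.relDepth) / 2) r.relDepth := by
  have h : (1 + (b.depth : ℝ) / 2 ^ N) / 2 = (2 ^ N + b.depth) / 2 ^ (N + 1) := by
    rw [pow_succ]; field_simp
  rw [relDepth, relDepth, relDepth, depth, if_neg (by decide), Nat.cast_max, h,
    max_div_div_right (by positivity), Nat.cast_add, Nat.cast_pow, Nat.cast_two]

/-- The weight of a tree if its rescaled depth is at most `y`, and `0` otherwise. -/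
noncomputable def massLe (u y : ℝ) (t : PassageTree N) : ℝ≥0∞ :=
  if t.relDepth ≤ y then mass u t else 0

section Left

variable {u y : ℝ}

lemma massLe_final_of_lt_half (a b : PassageTree N) :
    massLe u y (final a b) = ENNReal.ofReal (xParam u) * (massLe u (2 * y) a * mass u b) := by
  simp only [massLe, relDepth_final, mass_final, div_le_iff₀' (zero_lt_two' ℝ)]
  split_ifs <;> simp

/-- Below depth `1/2` no excursion goes to the left, and an excursion to the right is constrained
only in its outward half. -/
lemma massLe_excursion_of_lt_half (hy : y < 1 / 2) (e : ℤˣ) (a b : PassageTree N)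
    (r : PassageTree (N + 1)) : massLe u y (excursion e a b r) =
      (if e = 1 then ENNReal.ofReal ((1 - xParam u) / 2) * (massLe u (2 * y) a * mass u b) else 0) *
        massLe u y r := by
  rcases Int.units_eq_one_or e with rfl | rfl
  · simp only [massLe, relDepth_excursion_one, max_le_iff, div_le_iff₀' (zero_lt_two' ℝ),
      mass_excursion, if_true, ite_and]
    split_ifs <;> simp
  · have too_deep : ¬ (1 + b.relDepth) / 2 ≤ y := by linarith [b.relDepth_nonneg]
    simp only [massLe, relDepth_excursion_neg_one, max_le_iff, too_deep, false_and, if_false,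
      show ¬ (-1 : ℤˣ) = 1 by decide, zero_mul]

lemma tsum_massLe_of_lt_half (hy : y < 1 / 2) {z : ℝ} (hz : z ∈ Icc (0 : ℝ) 1)
    (sum_eq : ∑' t : PassageTree N, massLe u (2 * y) t = ENNReal.ofReal z) :
    ∑' t : PassageTree (N + 1), massLe u y t =
      ENNReal.ofReal (moebius (deRhamMatrix0 u) z) := by
  have hx := xParam_pos u
  have hc := half_one_sub_xParam_nonneg u
  rw [moebius_deRhamMatrix0]
  refine tsum_eq_of_multiplicative (massLe_excursion_of_lt_half hy) ?_ (mul_nonneg hx.le hz.1) ?_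
    (mul_nonneg hc hz.1) (by nlinarith [hz.2])
  · simp only [massLe_final_of_lt_half, ENNReal.tsum_mul_left, tsum_mass, mul_one, sum_eq,
      ENNReal.ofReal_mul hx.le]
  · simp only [tsum_intUnits, if_true, show ¬ (-1 : ℤˣ) = 1 by decide, if_false, tsum_zero,
      add_zero, ENNReal.tsum_mul_left, tsum_mass, mul_one, sum_eq, ENNReal.ofReal_mul hc]

end Left

section Right

variable {u y : ℝ}

lemma massLe_final_of_half_le (hy : 1 / 2 ≤ y) (a b : PassageTree N) :
    massLe u y (final a b) = ENNReal.ofReal (xParam u) * (mass u a * mass u b) := by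
  rw [massLe, relDepth_final, if_pos (by linarith [a.relDepth_lt_one]), mass_final]

/-- Above depth `1/2` only the return half of an excursion to the left is constrained. -/
lemma massLe_excursion_of_half_le (hy : 1 / 2 ≤ y) (e : ℤˣ) (a b : PassageTree N)
    (r : PassageTree (N + 1)) : massLe u y (excursion e a b r) =
      ENNReal.ofReal ((1 - xParam u) / 2) *
        (mass u a * if e = 1 then mass u b else massLe u (2 * y - 1) b) * massLe u y r := by
  rcases Int.units_eq_one_or e with rfl | rfl
  · have shallow : a.relDepth / 2 ≤ y := by linarith [a.relDepth_lt_one]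
    simp only [massLe, relDepth_excursion_one, max_le_iff, shallow, true_and, mass_excursion,
      if_true, mul_ite, mul_zero]
  · have shallow_iff : (1 + b.relDepth) / 2 ≤ y ↔ b.relDepth ≤ 2 * y - 1 := by
      constructor <;> intro <;> linarith
    simp only [massLe, relDepth_excursion_neg_one, max_le_iff, shallow_iff, mass_excursion,
      show ¬ (-1 : ℤˣ) = 1 by decide, if_false, ite_and]
    split_ifs <;> simp

lemma tsum_massLe_of_half_le (hy : 1 / 2 ≤ y) {z : ℝ} (hz : z ∈ Icc (0 : ℝ) 1)
    (sum_eq : ∑' t : PassageTree N, massLe u (2 * y - 1) t = ENNReal.ofReal z) :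
    ∑' t : PassageTree (N + 1), massLe u y t =
      ENNReal.ofReal (moebius (deRhamMatrix1 u) z) := by
  have hx := xParam_pos u
  have hc := half_one_sub_xParam_nonneg u
  have hz0 : 0 ≤ 1 + z := by linarith [hz.1]
  rw [moebius_deRhamMatrix1]
  refine tsum_eq_of_multiplicative (massLe_excursion_of_half_le hy) ?_ hx.le ?_
    (mul_nonneg hc hz0) (by nlinarith [hz.2])
  · simp only [massLe_final_of_half_le hy, ENNReal.tsum_mul_left, tsum_mass, mul_one]
  · simp only [tsum_intUnits, if_true, show ¬ (-1 : ℤˣ) = 1 by decide, if_false,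
      ENNReal.tsum_mul_left, ENNReal.tsum_mul_right, tsum_mass, one_mul, sum_eq]
    rw [ENNReal.ofReal_mul hc, ENNReal.ofReal_add zero_le_one hz.1, ENNReal.ofReal_one, mul_one_add]

end Right

lemma tsum_massLe (u : ℝ) (N : ℕ) (y : ℝ) :
    ∑' t : PassageTree N, massLe u y t =
      ENNReal.ofReal (approxCdf (moebius (deRhamMatrix0 u)) (moebius (deRhamMatrix1 u)) N y) := by
  induction N generalizing y with
  | zero =>
    rw [tsum_zero_level, massLe, mass_unit, relDepth, depth, Nat.cast_zero, zero_div]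
    by_cases hy : 0 ≤ y <;> simp [approxCdf, hy]
  | succ N ih =>
    have mem := ((isDeRhamPair_moebius u).isUnitCdf_approxCdf N).mem_Icc
    rw [approxCdf, Function.iterate_succ_apply', deRhamStep]
    split_ifs with hy
    · exact tsum_massLe_of_lt_half hy (mem _) (ih _)
    · exact tsum_massLe_of_half_le (not_lt.1 hy) (mem _) (ih _)

end PassageTree

end PassageWeight

section Blocks

/-- The path `ω` has the steps `l`. -/
structure FinPath.HasSteps (ω : FinPath) (l : List ℤ) : Prop where
  len_eq : ω.len = l.length
  pos_eq : ∀ i ≤ l.length, ω.pos i = (l.take i).sum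

/-- The concatenation of signed paths, called blocks. -/
def concatSteps {N : ℕ} (bs : List (ℤˣ × PassageTree N)) : List ℤ :=
  bs.flatMap fun p => signed p.1 p.2.steps

/-- The time at which the `i`-th block of a concatenation ends. -/
def blockTime {N : ℕ} (bs : List (ℤˣ × PassageTree N)) (i : ℕ) : ℕ :=
  (concatSteps (bs.take i)).length

variable {N : ℕ} {bs : List (ℤˣ × PassageTree N)} {ω : FinPath} {l p r : List ℤ} {e : ℤˣ} {i k : ℕ}

lemma concatSteps_cons (b : ℤˣ × PassageTree N) (bs : List (ℤˣ × PassageTree N)) :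
    concatSteps (b :: bs) = signed b.1 b.2.steps ++ concatSteps bs :=
  List.flatMap_cons

lemma concatSteps_singleton (t : PassageTree N) : concatSteps [(1, t)] = t.steps := by
  simp [concatSteps]

lemma pow_dvd_sum_concatSteps (bs : List (ℤˣ × PassageTree N)) :
    (2 : ℤ) ^ N ∣ (concatSteps bs).sum := by
  induction bs with
  | nil => simp [concatSteps]
  | cons b bs ih =>
    rw [concatSteps_cons, List.sum_append, signed_sum, b.2.sum_steps]
    exact dvd_add (dvd_mul_left _ _) ih

lemma concatSteps_eq (hi : i < bs.length) :
    concatSteps bs = concatSteps (bs.take i) ++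
      (signed bs[i].1 bs[i].2.steps ++ concatSteps (bs.drop (i + 1))) := by
  conv_lhs => rw [← List.take_append_drop i bs, List.drop_eq_getElem_cons hi]
  rw [← concatSteps_cons, concatSteps, List.flatMap_append]
  rfl

lemma blockTime_zero (bs : List (ℤˣ × PassageTree N)) : blockTime bs 0 = 0 := by
  simp [blockTime, concatSteps]

lemma blockTime_length (bs : List (ℤˣ × PassageTree N)) :
    blockTime bs bs.length = (concatSteps bs).length := by simp [blockTime]

lemma blockTime_succ (hi : i < bs.length) :
    blockTime bs (i + 1) = blockTime bs i + bs[i].2.steps.length := by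
  rw [blockTime, List.take_succ_eq_append_getElem hi, concatSteps, List.flatMap_append,
    List.length_append, List.flatMap_singleton, signed_length]
  rfl

lemma blockTime_add_le (hi : i < bs.length) :
    blockTime bs i + bs[i].2.steps.length ≤ (concatSteps bs).length := by
  rw [concatSteps_eq hi, blockTime]
  simp only [List.length_append, signed_length]
  omega

namespace FinPath.HasSteps

lemma pos_blockTime_add (hω : ω.HasSteps (concatSteps bs)) (hi : i < bs.length)
    (hk : k ≤ bs[i].2.steps.length) :
    ω.pos (blockTime bs i + k) =
      (concatSteps (bs.take i)).sum + bs[i].1 * (bs[i].2.steps.take k).sum := by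
  rw [hω.pos_eq _ ((Nat.add_le_add_left hk _).trans (blockTime_add_le hi))]
  conv_lhs => rw [concatSteps_eq hi, blockTime, List.take_length_add_append,
    List.take_append_of_le_length (by simpa using hk)]
  rw [List.sum_append, signed_take, signed_sum]

lemma pos_blockTime (hω : ω.HasSteps (concatSteps bs)) (hi : i < bs.length) :
    ω.pos (blockTime bs i) = (concatSteps (bs.take i)).sum := by
  simpa using hω.pos_blockTime_add hi (Nat.zero_le _)

lemma pos_blockTime_succ (hω : ω.HasSteps (concatSteps bs)) (hi : i < bs.length) :
    ω.pos (blockTime bs (i + 1)) = ω.pos (blockTime bs i) + bs[i].1 * 2 ^ N := by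
  rw [blockTime_succ hi, hω.pos_blockTime_add hi le_rfl, List.take_length, PassageTree.sum_steps,
    hω.pos_blockTime hi]

/-- Inside a block the path stays within distance less than `2^N` of the block's start. -/
lemma pos_eq_pos_blockTime_of_dvd (hω : ω.HasSteps (concatSteps bs)) (hi : i < bs.length)
    (hk : k < bs[i].2.steps.length) (hdvd : (2 : ℤ) ^ N ∣ ω.pos (blockTime bs i + k)) :
    ω.pos (blockTime bs i + k) = ω.pos (blockTime bs i) := by
  have displacement_lt := bs[i].2.firstPassage_steps.abs_lt k hk
  rw [← abs_unit_mul bs[i].1] at displacement_lt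
  rw [hω.pos_blockTime_add hi hk.le] at hdvd ⊢
  rw [dvd_add_right (pow_dvd_sum_concatSteps _)] at hdvd
  rw [Int.eq_zero_of_abs_lt_dvd hdvd displacement_lt, add_zero, hω.pos_blockTime hi]

lemma decTime_eq (hω : ω.HasSteps (concatSteps bs)) (hi : i ≤ bs.length) :
    ω.decTime N i = (blockTime bs i : ℕ∞) := by
  induction i with
  | zero => simp [FinPath.decTime, blockTime_zero]
  | succ i ih =>
    have hi' : i < bs.length := hi
    have length_pos : 0 < bs[i].2.steps.length := List.length_pos_iff.2 bs[i].2.steps_ne_nil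
    rw [FinPath.decTime, ih hi'.le, ENat.toNat_natCast]
    refine le_antisymm (sInf_le ⟨_, rfl, ?_, ?_, ?_, ?_⟩) (le_sInf ?_)
    · rw [Nat.cast_lt, blockTime_succ hi']; omega
    · rw [hω.len_eq, blockTime_succ hi']; exact blockTime_add_le hi'
    · rw [hω.pos_blockTime_succ hi', hω.pos_blockTime hi']
      exact dvd_add (pow_dvd_sum_concatSteps _) (dvd_mul_left _ _)
    · rw [hω.pos_blockTime_succ hi', ne_eq, add_eq_left]
      exact mul_ne_zero (Units.ne_zero _) (by positivity)
    · rintro _ ⟨j, rfl, hj, -, hdvd, hne⟩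
      rw [Nat.cast_lt] at hj
      rw [Nat.cast_le, blockTime_succ hi']
      by_contra! hlt
      obtain ⟨k, rfl⟩ := Nat.exists_eq_add_of_le hj.le
      exact hne (hω.pos_eq_pos_blockTime_of_dvd hi' (by omega) hdvd)

lemma decTime_eq_top (hω : ω.HasSteps (concatSteps bs)) (hi : bs.length < i) :
    ω.decTime N i = ⊤ := by
  induction i with
  | zero => omega
  | succ i ih =>
    rw [FinPath.decTime]
    refine sInf_eq_top.2 ?_
    rintro _ ⟨j, rfl, lt_j, j_le, -, -⟩
    rcases (Nat.lt_succ_iff.1 hi).lt_or_eq with h | rfl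
    · rw [ih h] at lt_j
      exact absurd lt_j not_top_lt
    · rw [hω.decTime_eq le_rfl, Nat.cast_lt, blockTime_length, ← hω.len_eq] at lt_j
      omega

lemma decimate_len (hω : ω.HasSteps (concatSteps bs)) : (ω.decimate N).len = bs.length := by
  have finite_times : {i : ℕ | ω.decTime N i < ⊤} = Iic bs.length := by
    ext i
    rcases le_or_gt i bs.length with h | h
    · simp [hω.decTime_eq h, h]
    · simp [hω.decTime_eq_top h, h]
  rw [FinPath.decimate, finite_times, csSup_Iic]

lemma segment (hω : ω.HasSteps (concatSteps bs)) (hi : i < bs.length) :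
    (ω.segment N (i + 1)).HasSteps bs[i].2.steps := by
  have pow_pos : (0 : ℤ) < 2 ^ N := by positivity
  refine ⟨?_, fun k hk => ?_⟩
  · simp only [FinPath.segment, Nat.add_sub_cancel, hω.decTime_eq hi, hω.decTime_eq hi.le,
      ENat.toNat_natCast, blockTime_succ hi, add_tsub_cancel_left]
  · simp only [FinPath.segment, Nat.add_sub_cancel, hω.decTime_eq hi, hω.decTime_eq hi.le,
      ENat.toNat_natCast]
    rw [hω.pos_blockTime_succ hi, hω.pos_blockTime_add hi hk, hω.pos_blockTime hi,
      add_sub_cancel_left, add_sub_cancel_left, Int.sign_mul, Int.sign_eq_one_of_pos pow_pos]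
    rcases Int.units_eq_one_or bs[i].1 with h | h <;> simp [h]

lemma isWalk (h : ω.HasSteps l) (hl : IsSteps l) : ω.IsWalk := by
  refine ⟨by simpa using h.pos_eq 0 (Nat.zero_le _), fun i hi => ?_⟩
  rw [h.len_eq] at hi
  rw [h.pos_eq _ hi.le, h.pos_eq _ hi, List.sum_take_succ _ _ hi, sub_add_cancel_left, abs_neg]
  exact hl _ (List.getElem_mem hi)

lemma memPlus {t : PassageTree N} (h : ω.HasSteps t.steps) : ω.MemPlus N := by
  have single_block : ω.HasSteps (concatSteps [(1, t)]) := by rwa [concatSteps_singleton]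
  refine ⟨h.isWalk t.isSteps_steps, ?_, ?_⟩
  · rw [single_block.decTime_eq (i := 1) le_rfl, single_block.len_eq]
    exact congrArg _ (blockTime_length [(1, t)]).symm
  · rw [h.len_eq, h.pos_eq _ le_rfl, List.take_length, t.sum_steps]

lemma decTime_one_le (hω : ω.HasSteps (signed e p ++ r)) (hp : FirstPassage (2 ^ N) p) :
    ω.decTime N 1 ≤ p.length := by
  have pow_ne_zero : (2 : ℤ) ^ N ≠ 0 := by positivity
  have p_ne_nil : p ≠ [] := by
    rintro rfl
    exact pow_ne_zero hp.sum_eq.symm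
  have start : ω.pos 0 = 0 := by simpa using hω.pos_eq 0 (Nat.zero_le _)
  have pos_eq : ω.pos p.length = e * 2 ^ N := by
    rw [hω.pos_eq _ (by simp), List.take_left' (signed_length e p), signed_sum, hp.sum_eq]
  refine sInf_le ⟨_, rfl, ?_, ?_, ?_, ?_⟩
  · simpa [decTime] using List.length_pos_iff.2 p_ne_nil
  · simp [hω.len_eq]
  · rw [pos_eq]; exact dvd_mul_left _ _
  · rw [pos_eq, decTime, ENat.toNat_zero, start]
    exact mul_ne_zero (Units.ne_zero _) pow_ne_zero

end FinPath.HasSteps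

namespace FinPath

lemma IsWalk.exists_hasSteps (h : ω.IsWalk) : ∃ l, IsSteps l ∧ ω.HasSteps l := by
  refine ⟨(List.range ω.len).map fun i => ω.pos (i + 1) - ω.pos i, ?_, by simp, fun i hi => ?_⟩
  · intro s hs
    obtain ⟨i, hi, rfl⟩ := List.mem_map.1 hs
    rw [abs_sub_comm]
    exact h.2 i (List.mem_range.1 hi)
  · rw [List.length_map, List.length_range] at hi
    induction i with
    | zero => simpa using h.1
    | succ i ih =>
      rw [List.sum_take_succ _ _ (by simpa using hi), ← ih (by omega)]
      simp

lemma MemPlus.exists_hasSteps (h : ω.MemPlus N) : ∃ t : PassageTree N, ω.HasSteps t.steps := by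
  obtain ⟨walk, len_eq, end_eq⟩ := h
  obtain ⟨l, hl, hs⟩ := walk.exists_hasSteps
  have pow_pos : (0 : ℤ) < 2 ^ N := by positivity
  have sum_eq : l.sum = 2 ^ N := by
    rw [← end_eq, hs.len_eq, hs.pos_eq _ le_rfl, List.take_length]
  obtain ⟨e, p, r, hp, rfl⟩ := hl.exists_firstPassage pow_pos (by rw [sum_eq, abs_of_pos pow_pos])
  obtain rfl : r = [] := by
    have len_le := hs.decTime_one_le hp
    rw [← len_eq, Nat.cast_le, hs.len_eq, List.length_append, signed_length] at len_le
    exact List.length_eq_zero_iff.1 (by omega)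
  obtain rfl : e = 1 := by
    rw [List.append_nil, signed_sum, hp.sum_eq, mul_eq_right₀ pow_pos.ne'] at sum_eq
    exact Units.ext sum_eq
  obtain ⟨t, rfl⟩ := PassageTree.exists_steps_eq hp
  exact ⟨t, by simpa using hs⟩

lemma decTime_neg (N : ℕ) (ω : FinPath) (i : ℕ) : ω.neg.decTime N i = ω.decTime N i := by
  induction i with
  | zero => rfl
  | succ i ih =>
    rw [decTime, decTime, ih]
    simp only [neg, dvd_neg, ne_eq, neg_inj]

lemma memPlus_neg_iff : ω.neg.MemPlus N ↔ ω.MemMinus N := by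
  rw [MemPlus, MemMinus, decTime_neg]
  refine and_congr ?_ (and_congr Iff.rfl ?_)
  · simp only [IsWalk, neg, neg_eq_zero, ← neg_sub', abs_neg]
  · simp only [neg, neg_eq_iff_eq_neg]

end FinPath

namespace PassageTree

/-- The coarse steps of a path together with the corresponding pieces of the path. -/
def blocks : PassageTree (N + 1) → List (ℤˣ × PassageTree N)
  | final a b => [(1, a), (1, b)]
  | excursion e a b r => (e, a) :: (-e, b) :: r.blocks

lemma concatSteps_blocks : ∀ t : PassageTree (N + 1), concatSteps t.blocks = t.steps
  | final a b => by simp [concatSteps, blocks, steps]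
  | excursion e a b r => by
    rw [blocks, concatSteps_cons, concatSteps_cons, concatSteps_blocks r, steps]

lemma two_le_length_blocks : ∀ t : PassageTree (N + 1), 2 ≤ t.blocks.length
  | final _ _ => by simp [blocks]
  | excursion _ _ _ _ => by simp [blocks]

lemma weight_eq_blocks (u : ℝ) : ∀ t : PassageTree (N + 1),
    t.weight u = u ^ (t.blocks.length - 2) * xParam u ^ (t.blocks.length - 1) *
      (t.blocks.map fun p => p.2.weight u).prod
  | final a b => by simp [weight, blocks]
  | excursion e a b r => by
    obtain ⟨k, hk⟩ := Nat.exists_eq_add_of_le (two_le_length_blocks r)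
    simp only [weight, weight_eq_blocks u r, blocks, List.length_cons, List.map_cons,
      List.prod_cons]
    rw [hk, show 2 + k + 1 + 1 - 2 = k + 2 by omega, show 2 + k + 1 + 1 - 1 = k + 3 by omega,
      show 2 + k - 2 = k by omega, show 2 + k - 1 = k + 1 by omega]
    ring

lemma weight_zero_level (u : ℝ) (t : PassageTree 0) : t.weight u = 1 := by
  cases t; rfl

lemma length_concatSteps_zero_level (bs : List (ℤˣ × PassageTree 0)) :
    (concatSteps bs).length = bs.length := by
  induction bs with
  | nil => rfl
  | cons b bs ih =>
    obtain ⟨e, t⟩ := b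
    cases t
    rw [concatSteps_cons, List.length_append, signed_length, ih, steps, List.length_singleton,
      List.length_cons, add_comm]

lemma massPlus_eq_weight (u : ℝ) {t : PassageTree (N + 1)} (h : ω.HasSteps t.steps) :
    massPlus u (N + 1) ω = t.weight u := by
  induction N generalizing ω with
  | zero =>
    rw [massPlus, weight_eq_blocks, h.len_eq, ← concatSteps_blocks,
      length_concatSteps_zero_level]
    simp [weight_zero_level]
  | succ N ih =>
    rw [← concatSteps_blocks] at h
    rw [massPlus, massPlus, weight_eq_blocks, h.decimate_len]
    congr 1
    rw [← Finset.Ico_add_one_right_eq_Icc, Finset.prod_Ico_eq_prod_range, Nat.add_sub_cancel,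
      Finset.prod_range, ← Fin.prod_univ_fun_getElem]
    refine Finset.prod_congr rfl fun i _ => ?_
    rw [add_comm 1 (i : ℕ)]
    exact ih (h.segment i.2)

end PassageTree

end Blocks


section Cylinders

/-- The infinite walks that start with the given steps. -/
def stepCylinder (l : List ℤ) : Set InfWalk := {η | ∀ i ≤ l.length, η.1 i = (l.take i).sum}

lemma isClopen_stepCylinder (l : List ℤ) : IsClopen (stepCylinder l) := by
  have eq_iInter : stepCylinder l = ⋂ i ∈ Finset.range (l.length + 1),
      (fun η : InfWalk => η.1 i) ⁻¹' {(l.take i).sum} := by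
    ext η
    simp [stepCylinder]
  rw [eq_iInter]
  exact isClopen_biInter_finset fun i _ => (isClopen_discrete _).preimage
    ((continuous_apply i).comp continuous_subtype_val)

lemma stepCylinder_append_subset (l r : List ℤ) : stepCylinder (l ++ r) ⊆ stepCylinder l := by
  intro η hη i hi
  rw [hη i (by rw [List.length_append]; omega), List.take_append_of_le_length hi]

lemma take_eq_of_sum_take_eq {l l' : List ℤ} (hle : l.length ≤ l'.length)
    (h : ∀ i ≤ l.length, (l.take i).sum = (l'.take i).sum) : l'.take l.length = l := by
  refine List.ext_getElem (by simpa using hle) fun i _ hi => ?_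
  have sums_succ := h (i + 1) hi
  rw [List.sum_take_succ _ _ hi, List.sum_take_succ _ _ (hi.trans_le hle), h i hi.le] at sums_succ
  rw [List.getElem_take]
  exact (add_left_cancel sums_succ).symm

namespace PassageTree

variable {N : ℕ} {p q : ℤˣ × PassageTree N} {η : InfWalk}

/-- The infinite walks whose initial piece is the path described by a tree, up to a sign. -/
def signedCylinder (p : ℤˣ × PassageTree N) : Set InfWalk := stepCylinder (signed p.1 p.2.steps)

lemma measurableSet_signedCylinder (p : ℤˣ × PassageTree N) : MeasurableSet (signedCylinder p) :=
  (isClopen_stepCylinder _).isClosed.measurableSet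

lemma eq_of_mem_signedCylinder (hp : η ∈ signedCylinder p) (hq : η ∈ signedCylinder q) : p = q := by
  wlog hle : p.2.steps.length ≤ q.2.steps.length generalizing p q
  · exact (this hq hp (not_le.1 hle).le).symm
  have is_prefix :
      (signed q.1 q.2.steps).take (signed p.1 p.2.steps).length = signed p.1 p.2.steps := by
    refine take_eq_of_sum_take_eq (by simpa using hle) fun i hi => ?_
    rw [← hp i hi, ← hq i (hi.trans (by simpa using hle))]
  have split := List.take_append_drop (signed p.1 p.2.steps).length (signed q.1 q.2.steps)
  rw [is_prefix] at split
  obtain ⟨signs_eq, steps_eq, -⟩ :=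
    steps_append_inj (s := []) (split.trans (List.append_nil _).symm)
  exact Prod.ext signs_eq (steps_injective steps_eq)

lemma pairwise_disjoint_signedCylinder (N : ℕ) :
    Pairwise (Function.onFun Disjoint (signedCylinder : ℤˣ × PassageTree N → Set InfWalk)) :=
  fun _ _ hpq => Set.disjoint_left.2 fun _ hp hq => hpq (eq_of_mem_signedCylinder hp hq)

/-- The trees of level `N + 1` whose first piece is the signed path `p`, indexed by the rest of
the path. -/
def extend (p : ℤˣ × PassageTree N) :
    PassageTree N ⊕ (PassageTree (N + 1) × ℤˣ × PassageTree N) → ℤˣ × PassageTree (N + 1)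
  | Sum.inl b => (p.1, final p.2 b)
  | Sum.inr (r, e, b) => (p.1 * e, excursion e p.2 b r)

lemma extend_injective (p : ℤˣ × PassageTree N) : Function.Injective (extend p) := by
  rintro (b | ⟨r, e, b⟩) (b' | ⟨r', e', b'⟩) h <;> simp_all [extend]

lemma signedCylinder_extend_subset (p : ℤˣ × PassageTree N)
    (s : PassageTree N ⊕ (PassageTree (N + 1) × ℤˣ × PassageTree N)) :
    signedCylinder (extend p s) ⊆ signedCylinder p := by
  rcases s with b | ⟨r, e, b⟩
  · rw [signedCylinder, extend, steps, signed_append]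
    exact stepCylinder_append_subset _ _
  · rw [signedCylinder, extend, steps, signed_append, signed_signed, mul_assoc, Int.units_mul_self,
      mul_one]
    exact stepCylinder_append_subset _ _

lemma tsum_signed_mass (u : ℝ) (N : ℕ) : ∑' p : ℤˣ × PassageTree N, p.2.mass u / 2 = 1 := by
  rw [ENNReal.tsum_prod', tsum_intUnits]
  simp only [div_eq_mul_inv, ENNReal.tsum_mul_right, tsum_mass, one_mul]
  exact ENNReal.inv_two_add_inv_two

lemma tsum_mass_extend (u : ℝ) (p : ℤˣ × PassageTree N) :
    ∑' s, (extend p s).2.mass u = p.2.mass u := by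
  have hc := half_one_sub_xParam_nonneg u
  have sum_eq_one : ENNReal.ofReal (xParam u) +
      (ENNReal.ofReal ((1 - xParam u) / 2) + ENNReal.ofReal ((1 - xParam u) / 2)) = 1 := by
    rw [← ENNReal.ofReal_add hc hc, add_halves,
      ← ENNReal.ofReal_add (xParam_pos u).le (by linarith), add_sub_cancel, ENNReal.ofReal_one]
  rw [ENNReal.summable.tsum_sum (by exact ENNReal.summable)]
  simp only [extend, mass_final, mass_excursion, ENNReal.tsum_prod', tsum_intUnits,
    ENNReal.tsum_mul_right, ENNReal.tsum_mul_left, tsum_mass, mul_one]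
  rw [one_add_one_eq_two, mul_two, mul_add, ← add_mul, ← add_mul, sum_eq_one, one_mul]

/-- The measure `P` gives the cylinders over the signed paths of level `N` the masses prescribed
for the Denker–Hattori law. -/
def IsLevelLaw (u : ℝ) (N : ℕ) (P : Measure InfWalk) : Prop :=
  ∀ p : ℤˣ × PassageTree N, P (signedCylinder p) = p.2.mass u / 2

namespace IsLevelLaw

variable {u : ℝ} {P : Measure InfWalk}

lemma measure_iUnion_signedCylinder (h : IsLevelLaw u N P) :
    P (⋃ p : ℤˣ × PassageTree N, signedCylinder p) = 1 := by
  rw [measure_iUnion (pairwise_disjoint_signedCylinder N) measurableSet_signedCylinder,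
    tsum_congr h, tsum_signed_mass]

lemma mass_div_two_le (h : IsLevelLaw u (N + 1) P) (p : ℤˣ × PassageTree N) :
    p.2.mass u / 2 ≤ P (signedCylinder p) :=
  calc
    p.2.mass u / 2 = ∑' s, P (signedCylinder (extend p s)) := by
      rw [tsum_congr fun s => h (extend p s), ← tsum_mass_extend u p]
      simp only [div_eq_mul_inv, ENNReal.tsum_mul_right]
    _ = P (⋃ s, signedCylinder (extend p s)) :=
      (measure_iUnion (f := fun s => signedCylinder (extend p s))
        (fun s t hst => pairwise_disjoint_signedCylinder _ ((extend_injective p).ne hst))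
        fun s => measurableSet_signedCylinder _).symm
    _ ≤ P (signedCylinder p) :=
      measure_mono (iUnion_subset fun s => signedCylinder_extend_subset p s)

variable [IsProbabilityMeasure P]

/-- The cylinders have at least the prescribed masses, which already add up to `1`. -/
lemma of_succ (h : IsLevelLaw u (N + 1) P) : IsLevelLaw u N P := by
  intro p
  by_contra hne
  have sum_lt := ENNReal.tsum_lt_tsum (by rw [tsum_signed_mass]; exact ENNReal.one_ne_top)
    h.mass_div_two_le ((h.mass_div_two_le p).lt_of_ne' hne)
  rw [tsum_signed_mass, ← measure_iUnion (pairwise_disjoint_signedCylinder N)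
    measurableSet_signedCylinder] at sum_lt
  exact absurd prob_le_one (not_le.2 sum_lt)

lemma of_le {M : ℕ} (hMN : M ≤ N) (h : IsLevelLaw u N P) : IsLevelLaw u M P := by
  induction hMN with
  | refl => exact h
  | step _ ih => exact ih h.of_succ

end IsLevelLaw

lemma ofReal_weight_div_two (u : ℝ) (t : PassageTree N) :
    ENNReal.ofReal (t.weight u / 2) = t.mass u / 2 := by
  rw [ENNReal.ofReal_div_of_pos two_pos, ENNReal.ofReal_ofNat, mass]

end PassageTree

namespace FinPath

variable {ω : FinPath} {l : List ℤ}

lemma neg_neg (ω : FinPath) : ω.neg.neg = ω := by simp [neg]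

lemma hasSteps_mk (l : List ℤ) : (FinPath.mk l.length fun i => (l.take i).sum).HasSteps l :=
  ⟨rfl, fun _ _ => rfl⟩

namespace HasSteps

lemma cylinderOf_eq (h : ω.HasSteps l) : cylinderOf ω = stepCylinder l := by
  ext η
  simp only [cylinderOf, stepCylinder, mem_ofPred_eq, h.len_eq]
  exact forall₂_congr fun i hi => by rw [h.pos_eq i hi]

lemma neg (h : ω.HasSteps l) : ω.neg.HasSteps (signed (-1) l) :=
  ⟨by simpa [FinPath.neg] using h.len_eq, fun i hi => by
    simpa [FinPath.neg] using h.pos_eq i (by simpa using hi)⟩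

end HasSteps

end FinPath

open PassageTree in
lemma isDenkerHattoriLaw_iff {u : ℝ} {P : ProbabilityMeasure InfWalk} :
    IsDenkerHattoriLaw u P ↔ ∀ N, IsLevelLaw u (N + 1) P := by
  constructor
  · rintro h N ⟨e, t⟩
    have ht := FinPath.hasSteps_mk t.steps
    rcases Int.units_eq_one_or e with rfl | rfl
    · rw [signedCylinder, signed_one, ← ht.cylinderOf_eq, (h (N + 1) (by omega) _).1 ht.memPlus,
        massPlus_eq_weight u ht, ofReal_weight_div_two]
    · have memMinus := FinPath.memPlus_neg_iff.1 (by rw [FinPath.neg_neg]; exact ht.memPlus)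
      rw [signedCylinder, ← ht.neg.cylinderOf_eq, (h (N + 1) (by omega) _).2 memMinus, massMinus,
        FinPath.neg_neg, massPlus_eq_weight u ht, ofReal_weight_div_two]
  · intro h N hN ω
    obtain ⟨N, rfl⟩ := Nat.exists_eq_add_of_le' hN
    constructor
    · intro hω
      obtain ⟨t, ht⟩ := hω.exists_hasSteps
      rw [ht.cylinderOf_eq, massPlus_eq_weight u ht, ofReal_weight_div_two, ← h N (1, t),
        signedCylinder, signed_one]
    · intro hω
      obtain ⟨t, ht⟩ := (FinPath.memPlus_neg_iff.2 hω).exists_hasSteps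
      have ht_neg := ht.neg
      rw [FinPath.neg_neg] at ht_neg
      rw [ht_neg.cylinderOf_eq, massMinus, massPlus_eq_weight u ht, ofReal_weight_div_two,
        ← h N (-1, t), signedCylinder]

end Cylinders

section Existence

/-- The walk with given steps, continued by steps `+1`. -/
def continuation (l : List ℤ) (hl : IsSteps l) : InfWalk :=
  ⟨fun i => (l.take i).sum + ((i - l.length : ℕ) : ℤ), by simp, fun i => by
    dsimp only
    rcases lt_or_ge i l.length with h | h
    · have := hl _ (List.getElem_mem h)
      rw [List.sum_take_succ _ _ h, Nat.sub_eq_zero_of_le h.le, Nat.sub_eq_zero_of_le h]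
      simpa using this
    · rw [List.take_of_length_le h, List.take_of_length_le (h.trans (Nat.le_succ i)),
        Nat.succ_sub h]
      simp⟩

lemma continuation_mem (l : List ℤ) (hl : IsSteps l) : continuation l hl ∈ stepCylinder l :=
  fun i hi => by simp [continuation, Nat.sub_eq_zero_of_le hi]

namespace PassageTree

variable {N : ℕ}

/-- A law on infinite walks with the prescribed masses of the cylinders of level `N`. -/
noncomputable def levelLaw (u : ℝ) (N : ℕ) : Measure InfWalk :=
  Measure.sum fun p : ℤˣ × PassageTree N =>
    (p.2.mass u / 2) • Measure.dirac (continuation _ (isSteps_signed p.2.isSteps_steps p.1))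

lemma isLevelLaw_levelLaw (u : ℝ) (N : ℕ) : IsLevelLaw u N (levelLaw u N) := by
  intro p
  rw [levelLaw, Measure.sum_apply _ (measurableSet_signedCylinder p),
    tsum_eq_single p fun q hq => ?_]
  · rw [Measure.smul_apply, Measure.dirac_apply_of_mem (by exact continuation_mem _ _),
      smul_eq_mul, mul_one]
  · rw [Measure.smul_apply, Measure.dirac_apply' _ (measurableSet_signedCylinder p),
      indicator_of_notMem, smul_zero]
    exact fun h => hq (eq_of_mem_signedCylinder (continuation_mem _ _) h)

instance (u : ℝ) (N : ℕ) : IsProbabilityMeasure (levelLaw u N) := by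
  constructor
  rw [levelLaw, Measure.sum_apply _ MeasurableSet.univ]
  simpa using tsum_signed_mass u N

end PassageTree

lemma abs_infWalk_le (η : InfWalk) (i : ℕ) : |η.1 i| ≤ i := by
  induction i with
  | zero => simp [η.2.1]
  | succ i ih =>
    have increment := abs_sub_abs_le_abs_sub (η.1 (i + 1)) (η.1 i)
    rw [abs_sub_comm, η.2.2 i] at increment
    push_cast
    linarith

instance : CompactSpace InfWalk := by
  refine ⟨?_⟩
  rw [IsEmbedding.subtypeVal.isCompact_iff, image_univ, Subtype.range_coe_subtype]
  refine (isCompact_univ_pi fun i : ℕ => isCompact_Icc (a := -(i : ℤ)) (b := i)).of_isClosed_subset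
    ?_ fun ω hω i _ => abs_le.1 (abs_infWalk_le ⟨ω, hω⟩ i)
  rw [ofPred_and, ofPred_forall]
  exact (isClosed_eq (by fun_prop) (by fun_prop)).inter
    (isClosed_iInter fun i => isClosed_eq (by fun_prop) (by fun_prop))

open PassageTree in
/-- Every level prescribes the masses of the lower levels, and cylinders are clopen; hence a
limit point of the level laws in the compact space of laws is consistent with all levels. -/
lemma exists_isDenkerHattoriLaw (u : ℝ) :
    ∃ P : ProbabilityMeasure InfWalk, IsDenkerHattoriLaw u P := by
  have : TopologicalSpace.PseudoMetrizableSpace InfWalk :=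
    IsInducing.pseudoMetrizableSpace (f := fun η : InfWalk => η.1) ⟨rfl⟩
  let := TopologicalSpace.pseudoMetrizableSpacePseudoMetric InfWalk
  let Q : ℕ → ProbabilityMeasure InfWalk := fun N => ⟨levelLaw u N, inferInstance⟩
  obtain ⟨P, -, hP⟩ := isCompact_univ.ultrafilter_le_nhds ((hyperfilter ℕ).map Q) (by simp)
  refine ⟨P, isDenkerHattoriLaw_iff.2 fun N p => ?_⟩
  have tendsto_measure : Tendsto
      (fun M => (Q M : Measure InfWalk) (signedCylinder p)) (hyperfilter ℕ)
      (𝓝 ((P : Measure InfWalk) (signedCylinder p))) :=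
    ProbabilityMeasure.tendsto_measure_of_null_frontier_of_tendsto' hP
      (by rw [signedCylinder, (isClopen_stepCylinder _).frontier_eq, measure_empty])
  have eventually_le : ∀ᶠ M in (hyperfilter ℕ : Filter ℕ), N + 1 ≤ M :=
    (Nat.cofinite_eq_atTop ▸ hyperfilter_le_cofinite) (eventually_ge_atTop (N + 1))
  refine tendsto_nhds_unique tendsto_measure (tendsto_const_nhds.congr' ?_)
  filter_upwards [eventually_le] with M hM
  exact ((isLevelLaw_levelLaw u M).of_le hM p).symm

end Existence

section ExcessRange

/-- The rescaled excess range `R_n / 2^n - 1`. -/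
noncomputable def excessRange (n : ℕ) (η : InfWalk) : ℝ := (walkRange n η : ℝ) / 2 ^ n - 1

namespace PassageTree

variable {N : ℕ} {p : ℤˣ × PassageTree N} {η : InfWalk}

lemma setOf_visited_before_eq (h : η ∈ signedCylinder p) :
    {x : ℤ | ∃ j : ℕ, η.1 j = x ∧ ∀ i ≤ j, η.1 i ≠ 2 ^ N ∧ η.1 i ≠ -2 ^ N} =
      visited (signed p.1 p.2.steps) := by
  obtain ⟨e, t⟩ := p
  have length_eq : (signed e t.steps).length = t.steps.length := signed_length _ _
  ext z
  constructor
  · rintro ⟨j, rfl, hj⟩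
    have j_lt : j < t.steps.length := by
      by_contra! hge
      have not_hit := hj t.steps.length hge
      rw [h _ length_eq.ge, signed_take, List.take_length, signed_sum, sum_steps] at not_hit
      rcases Int.units_eq_one_or e with rfl | rfl <;> simp at not_hit
    exact ⟨j, length_eq ▸ j_lt, (h j (length_eq ▸ j_lt.le)).symm⟩
  · rintro ⟨j, hj, rfl⟩
    refine ⟨j, h j hj.le, fun i hi => ?_⟩
    have abs_lt_pow := t.firstPassage_steps.abs_lt i (hi.trans_lt (length_eq ▸ hj))
    rw [h i (hi.trans hj.le), signed_take, signed_sum]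
    rw [← abs_unit_mul e, abs_lt] at abs_lt_pow
    exact ⟨abs_lt_pow.2.ne, abs_lt_pow.1.ne'⟩

lemma walkRange_of_mem_signedCylinder (h : η ∈ signedCylinder p) :
    walkRange N η = 2 ^ N + p.2.depth := by
  have pow_pos : (0 : ℤ) < 2 ^ N := by positivity
  have visited_eq : visited (signed p.1 p.2.steps) =
      (fun z => (p.1 : ℤ) * z) ⁻¹' Icc (-(p.2.depth : ℤ)) (2 ^ N - 1) := by
    ext z
    rw [mem_visited_signed, visited_steps, mem_preimage]
  rw [walkRange, setOf_visited_before_eq h, visited_eq,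
    ncard_preimage_of_injective_subset_range (mul_right_injective₀ (Units.ne_zero p.1))
      fun z _ => ⟨p.1 * z, by simp [← mul_assoc, ← Units.val_mul]⟩,
    ← Finset.coe_Icc, ncard_coe_finset, Int.card_Icc]
  zify
  rw [Int.toNat_of_nonneg (by linarith)]
  ring

lemma excessRange_of_mem_signedCylinder (h : η ∈ signedCylinder p) :
    excessRange N η = p.2.relDepth := by
  rw [excessRange, walkRange_of_mem_signedCylinder h, relDepth]
  push_cast
  rw [add_div, div_self (by positivity), add_sub_cancel_left]

lemma tsum_signed_massLe (u y : ℝ) (N : ℕ) :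
    ∑' p : ℤˣ × PassageTree N, massLe u y p.2 / 2 = ∑' t : PassageTree N, massLe u y t := by
  rw [ENNReal.tsum_prod', tsum_intUnits]
  simp only [div_eq_mul_inv, ENNReal.tsum_mul_right]
  rw [← mul_add, ENNReal.inv_two_add_inv_two, mul_one]

namespace IsLevelLaw

variable {u : ℝ} {P : Measure InfWalk} [IsProbabilityMeasure P]

lemma ae_mem_signedCylinder (h : IsLevelLaw u N P) :
    ∀ᵐ η ∂P, ∃ p : ℤˣ × PassageTree N, η ∈ signedCylinder p := by
  have compl_null := (prob_compl_eq_zero_iff (MeasurableSet.iUnion measurableSet_signedCylinder)).2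
    h.measure_iUnion_signedCylinder
  filter_upwards [compl_mem_ae_iff.2 compl_null] with η hη
  exact mem_iUnion.1 (not_not.1 hη)

lemma aemeasurable_excessRange (h : IsLevelLaw u N P) : AEMeasurable (excessRange N) P := by
  have restrict_eq : P.restrict (⋃ p : ℤˣ × PassageTree N, signedCylinder p) = P :=
    Measure.restrict_eq_self_of_ae_mem (by simpa using h.ae_mem_signedCylinder)
  rw [← restrict_eq, aemeasurable_iUnion_iff]
  refine fun p => (aemeasurable_const (b := p.2.relDepth)).congr ?_
  filter_upwards [ae_restrict_mem (measurableSet_signedCylinder p)] with η hη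
  exact (excessRange_of_mem_signedCylinder hη).symm

lemma excessRange_preimage_Iic_ae_eq (h : IsLevelLaw u N P) (y : ℝ) :
    (excessRange N ⁻¹' Iic y : Set InfWalk) =ᵐ[P]
      ⋃ p : ℤˣ × PassageTree N, {η ∈ signedCylinder p | p.2.relDepth ≤ y} := by
  filter_upwards [h.ae_mem_signedCylinder] with η ⟨p, hp⟩
  refine propext ⟨fun hy => mem_iUnion.2 ⟨p, hp, ?_⟩, fun hy => ?_⟩
  · rwa [← excessRange_of_mem_signedCylinder hp]
  · obtain ⟨q, hq, hqy⟩ := mem_iUnion.1 hy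
    exact (excessRange_of_mem_signedCylinder hq).trans_le hqy

lemma measure_excessRange_le (h : IsLevelLaw u N P) (y : ℝ) :
    P (excessRange N ⁻¹' Iic y) =
      ENNReal.ofReal (approxCdf (moebius (deRhamMatrix0 u)) (moebius (deRhamMatrix1 u)) N y) := by
  have measure_piece (p : ℤˣ × PassageTree N) :
      P {η ∈ signedCylinder p | p.2.relDepth ≤ y} = massLe u y p.2 / 2 := by
    by_cases hy : p.2.relDepth ≤ y
    · simpa [massLe, hy] using h p
    · simp [massLe, hy]
  rw [measure_congr (h.excessRange_preimage_Iic_ae_eq y), measure_iUnion, tsum_congr measure_piece,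
    tsum_signed_massLe, tsum_massLe]
  · exact fun p q hpq => (pairwise_disjoint_signedCylinder N hpq).mono (sep_subset _ _)
      (sep_subset _ _)
  · exact fun p => (measurableSet_signedCylinder p).inter (MeasurableSet.const _)

lemma cdf_map_excessRange (h : IsLevelLaw u N P) (y : ℝ) :
    cdf (P.map (excessRange N)) y =
      approxCdf (moebius (deRhamMatrix0 u)) (moebius (deRhamMatrix1 u)) N y := by
  have := Measure.isProbabilityMeasure_map h.aemeasurable_excessRange
  rw [cdf_eq_real, measureReal_def,
    Measure.map_apply_of_aemeasurable h.aemeasurable_excessRange measurableSet_Iic,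
    h.measure_excessRange_le,
    ENNReal.toReal_ofReal (((isDeRhamPair_moebius u).isUnitCdf_approxCdf N).mem_Icc y).1]

end IsLevelLaw

end PassageTree

lemma IsDenkerHattoriLaw.tendstoInDistribution_excessRange {u : ℝ} {P : ProbabilityMeasure InfWalk}
    (hP : IsDenkerHattoriLaw u P) :
    TendstoInDistribution excessRange atTop (id : ℝ → ℝ) (fun _ => (P : Measure InfWalk))
      ((isUnitCdf_deRhamCdf u).law : Measure ℝ) := by
  have level (n : ℕ) : PassageTree.IsLevelLaw u n P :=
    (isDenkerHattoriLaw_iff.1 hP n).of_succ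
  refine ⟨fun n => (level n).aemeasurable_excessRange, aemeasurable_id,
    tendsto_probabilityMeasure_of_tendsto_cdf fun y => ?_⟩
  simp only [ProbabilityMeasure.coe_mk, Measure.map_id, (level _).cdf_map_excessRange,
    IsUnitCdf.cdf_law]
  exact (isDeRhamPair_moebius u).tendsto_approxCdf y

end ExcessRange

theorem theorem1p2 (u : ℝ) (hu : 0 ≤ u) :
    (∃ P : ProbabilityMeasure InfWalk, IsDenkerHattoriLaw u P) ∧
    ∃ μ : ProbabilityMeasure ℝ,
      (μ : Measure ℝ) (Icc (0 : ℝ) 1) = 1 ∧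
      (∀ P : ProbabilityMeasure InfWalk, IsDenkerHattoriLaw u P →
        TendstoInDistribution
          (fun (n : ℕ) (ω : InfWalk) => (walkRange n ω : ℝ) / 2 ^ n - 1) atTop
          (id : ℝ → ℝ) (fun _ => (P : Measure InfWalk)) (μ : Measure ℝ)) ∧
      (0 < u → SatisfiesDeRham u (fun x => cdf (μ : Measure ℝ) x)) ∧
      (u = 1 → (μ : Measure ℝ) ≪ volume.restrict (Icc (0 : ℝ) 1)) ∧
      (u ≠ 1 → (μ : Measure ℝ) ⟂ₘ volume.restrict (Icc (0 : ℝ) 1)) := by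
  refine ⟨exists_isDenkerHattoriLaw u, (isUnitCdf_deRhamCdf u).law,
    (isUnitCdf_deRhamCdf u).law_Icc, fun P hP => hP.tendstoInDistribution_excessRange,
    fun hu_pos => ?_, ?_, fun hu_ne => ?_⟩
  · simpa only [IsUnitCdf.cdf_law] using satisfiesDeRham_deRhamCdf hu_pos.ne'
  · rintro rfl
    exact law_deRhamCdf_one_absolutelyContinuous
  · exact law_deRhamCdf_mutuallySingular (mt (xParam_eq_half_iff hu).1 hu_ne)
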